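/- Let $k$ be an algebraically closed field and let $n,t,r\ge 1$ and $m\ge 0$ be integers. Set $\alpha=\lceil tn/r\rceil$ and $\beta=\lfloor tn/r\rfloor$, and assume $$m\ \ge\ \max\left\{\frac{1}{4(t+r)}\binom{\alpha+n-1}{n}^2\binom{\alpha+n}{n},\ \frac{1}{4t}\binom{\beta+n-1}{n}^3\right\}.$$ Let $\phi:\mathcal{O}_{\mathbb{P}^n}^{m(t+r)}\to\mathcal{O}_{\mathbb{P}^n}(1)^{mt}$ be a general map on $\mathbb{P}^n=\mathbb{P}^n_k$, i.e. one given by an $mt\times m(t+r)$ matrix of linear forms in the homogeneous coordinates that lies in a suitable nonempty Zariski open subset of the affine space of all such matrices. Then $\phi$ is surjective, and its kernel $V$, defined by $$0\to V\to\mathcal{O}_{\mathbb{P}^n}^{m(t+r)}\xrightarrow{\ \phi\ }\mathcal{O}_{\mathbb{P}^n}(1)^{mt}\to 0,$$ has natural cohomology: for every $a\in\mathbb{Z}$, at most one of the cohomology groups $H^i(\mathbb{P}^n,V(a))$, $i\ge 0$, is nonzero. -/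

import Mathlib

open TopologicalSpace

noncomputable section

namespace SteinerBundle

/-! ### Projective space and the line bundles `O(d)` -/

/-- The homogeneous coordinate ring `k[x₀, …, xₙ]`. -/
abbrev CoordRing (k : Type*) [Field k] (n : ℕ) : Type _ := MvPolynomial (Fin (n + 1)) k

/-- The standard grading of `k[x₀, …, xₙ]` by total degree. -/
abbrev grading (k : Type*) [Field k] (n : ℕ) : ℕ → Submodule k (CoordRing k n) :=
  MvPolynomial.homogeneousSubmodule (Fin (n + 1)) k

instance instGradedAlgebraGrading (k : Type*) [Field k] (n : ℕ) : GradedAlgebra (grading k n) :=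
  MvPolynomial.gradedAlgebra

/-- Projective space `ℙⁿ = Proj k[x₀, …, xₙ]`, with its Zariski topology. -/
abbrev ProjSpace (k : Type*) [Field k] (n : ℕ) : Type _ := ProjectiveSpectrum (grading k n)

/-- The localization of `k[x₀, …, xₙ]` at the homogeneous prime ideal `x`. The stalk of `O(d)` at
`x` is its subgroup of fractions `g / h` with `g`, `h` homogeneous, `deg g = deg h + d`, `h ∉ x`. -/
abbrev LocalRing (k : Type*) [Field k] (n : ℕ) (x : ProjSpace k n) : Type _ :=
  Localization.AtPrime x.asHomogeneousIdeal.toIdeal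

/-- `s` is given on all of `U` by one fraction `g / h` of homogeneous polynomials with
`deg g = deg h + d`. -/
def IsFraction {k : Type*} [Field k] {n : ℕ} (d : ℤ) {U : Opens (ProjSpace k n)}
    (s : (x : U) → LocalRing k n x.1) : Prop :=
  ∃ (i j : ℕ) (g h : CoordRing k n), g ∈ grading k n i ∧ h ∈ grading k n j ∧ (i : ℤ) = j + d ∧
    ∀ x : U, ∃ hx : h ∉ x.1.asHomogeneousIdeal.toIdeal, s x = Localization.mk g ⟨h, hx⟩

/-- `s` is a section over `U` of the line bundle `O(d)`: it is locally on `U` a homogeneous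
fraction of degree `d`. -/
def IsTwistSection {k : Type*} [Field k] {n : ℕ} (d : ℤ) {U : Opens (ProjSpace k n)}
    (s : (x : U) → LocalRing k n x.1) : Prop :=
  ∀ x : U, ∃ (W : Opens (ProjSpace k n)) (hW : W ≤ U), x.1 ∈ W ∧
    IsFraction d (fun y : W => s ⟨y.1, hW y.2⟩)

section helpers

variable {k : Type*} [Field k] {n : ℕ} {d : ℤ} {U : Opens (ProjSpace k n)}

theorem exists_homogeneous_notMem (x : ProjSpace k n) :
    ∃ (i : ℕ) (f : CoordRing k n), 0 < i ∧ f ∈ grading k n i ∧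
      f ∉ x.asHomogeneousIdeal.toIdeal := by
  by_contra! hcon
  exact x.not_irrelevant_le ((HomogeneousIdeal.irrelevant_le _).mpr
    fun i hi f hf => hcon i f hi hf)

theorem IsTwistSection.zero : IsTwistSection d (fun _ : U => 0) := by
  intro x
  obtain ⟨i, f, hi, hf, hfx⟩ := exists_homogeneous_notMem x.1
  have hpow : f ^ d.natAbs ∈ grading k n (d.natAbs * i) := by
    simpa using SetLike.pow_mem_graded d.natAbs hf
  refine ⟨U ⊓ ProjectiveSpectrum.basicOpen (grading k n) (f ^ d.natAbs), inf_le_left,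
    ⟨x.2, fun h => hfx (x.1.isPrime.mem_of_pow_mem _ h)⟩,
    (d.natAbs * i + d).toNat, d.natAbs * i, 0, f ^ d.natAbs, zero_mem _, hpow, ?_, ?_⟩
  · have h1 : (1 : ℤ) ≤ i := by exact_mod_cast hi
    rw [Int.toNat_of_nonneg]
    · push_cast
      ring
    · have : -d ≤ |d| := neg_le_abs d
      push_cast
      nlinarith [abs_nonneg d]
  · intro y
    exact ⟨y.2.2, (Localization.mk_zero _).symm⟩

theorem IsTwistSection.add {s t : (x : U) → LocalRing k n x.1} (hs : IsTwistSection d s)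
    (ht : IsTwistSection d t) : IsTwistSection d (fun x => s x + t x) := by
  intro x
  obtain ⟨W, hW, hxW, i, j, g, h, hg, hh, hij, hfr⟩ := hs x
  obtain ⟨W', hW', hxW', i', j', g', h', hg', hh', hij', hfr'⟩ := ht x
  refine ⟨W ⊓ W', inf_le_left.trans hW, ⟨hxW, hxW'⟩, j + i', j + j', h * g' + h' * g, h * h',
    add_mem (SetLike.mul_mem_graded hh hg') ?_, SetLike.mul_mem_graded hh hh', ?_, ?_⟩
  · have := SetLike.mul_mem_graded hh' hg
    rwa [show j' + i = j + i' by omega] at this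
  · push_cast
    omega
  · intro y
    obtain ⟨hy, e⟩ := hfr ⟨y.1, y.2.1⟩
    obtain ⟨hy', e'⟩ := hfr' ⟨y.1, y.2.2⟩
    refine ⟨fun hmem => (y.1.isPrime.mem_or_mem hmem).elim hy hy', ?_⟩
    exact (congrArg₂ (· + ·) e e').trans (Localization.add_mk _ _ _ _)

theorem IsTwistSection.smul (c : k) {s : (x : U) → LocalRing k n x.1} (hs : IsTwistSection d s) :
    IsTwistSection d (fun x => c • s x) := by
  intro x
  obtain ⟨W, hW, hxW, i, j, g, h, hg, hh, hij, hfr⟩ := hs x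
  refine ⟨W, hW, hxW, i, j, c • g, h, Submodule.smul_mem _ _ hg, hh, hij, fun y => ?_⟩
  obtain ⟨hy, e⟩ := hfr y
  exact ⟨hy, (congrArg (c • ·) e).trans (Localization.smul_mk _ _ _)⟩

theorem IsTwistSection.restrict {W : Opens (ProjSpace k n)} (hWU : W ≤ U)
    {s : (x : U) → LocalRing k n x.1} (hs : IsTwistSection d s) :
    IsTwistSection d (fun x : W => s ⟨x.1, hWU x.2⟩) := by
  intro x
  obtain ⟨W', hW', hxW', i, j, g, h, hg, hh, hij, hfr⟩ := hs ⟨x.1, hWU x.2⟩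
  exact ⟨W ⊓ W', inf_le_left, ⟨x.2, hxW'⟩, i, j, g, h, hg, hh, hij,
    fun y => hfr ⟨y.1, y.2.2⟩⟩

end helpers

/-! ### Maps `O^p → O(1)^q` and their kernels -/

/-- Coefficients of a `q × p` matrix of linear forms in `x₀, …, xₙ`; this is the affine space
`Hom(O^p, O(1)^q)` on `ℙⁿ`. -/
abbrev LinearMatrix (k : Type*) (n p q : ℕ) : Type _ := Fin q × Fin p × Fin (n + 1) → k

/-- The entry `∑ₗ A(i,j,l) xₗ` of the matrix of linear forms. -/
def LinearMatrix.entry {k : Type*} [Field k] {n p q : ℕ} (A : LinearMatrix k n p q)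
    (i : Fin q) (j : Fin p) : CoordRing k n :=
  ∑ l : Fin (n + 1), A (i, j, l) • MvPolynomial.X l

/-- The matrix of linear forms applied to a tuple of germs at `x`. -/
def LinearMatrix.apply {k : Type*} [Field k] {n p q : ℕ} (A : LinearMatrix k n p q)
    {x : ProjSpace k n} (v : Fin p → LocalRing k n x) : Fin q → LocalRing k n x :=
  fun i => ∑ j : Fin p, algebraMap (CoordRing k n) (LocalRing k n x) (A.entry i j) * v j

/-- The map of sheaves `O^p → O(1)^q` is surjective: every section of the target lifts locally. -/
def LinearMatrix.IsSurjective {k : Type*} [Field k] {n p q : ℕ} (A : LinearMatrix k n p q) :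
    Prop :=
  ∀ (U : Opens (ProjSpace k n)) (w : (x : U) → Fin q → LocalRing k n x.1),
    (∀ i, IsTwistSection 1 (fun x => w x i)) →
    ∀ x : U, ∃ (W : Opens (ProjSpace k n)) (hW : W ≤ U)
      (s : (y : W) → Fin p → LocalRing k n y.1), x.1 ∈ W ∧
      (∀ j, IsTwistSection 0 (fun y => s y j)) ∧ ∀ y : W, A.apply (s y) = w ⟨y.1, hW y.2⟩

/-- The sections over `U` of the twist `V(a)` of the kernel `V` of `O^p → O(1)^q`, that is,
of the kernel of `O(a)^p → O(a+1)^q`. -/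
def kernelSections {k : Type*} [Field k] {n p q : ℕ} (A : LinearMatrix k n p q) (a : ℤ)
    (U : Opens (ProjSpace k n)) : Submodule k ((x : U) → Fin p → LocalRing k n x.1) where
  carrier := {s | (∀ j, IsTwistSection a (fun x => s x j)) ∧ ∀ x, A.apply (s x) = 0}
  zero_mem' := ⟨fun _ => IsTwistSection.zero, fun _ => by
    ext i
    simp [LinearMatrix.apply]⟩
  add_mem' := by
    rintro s t ⟨hs, hs'⟩ ⟨ht, ht'⟩
    refine ⟨fun j => (hs j).add (ht j), fun x => ?_⟩
    ext i
    have h1 := congrFun (hs' x) i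
    have h2 := congrFun (ht' x) i
    simp only [LinearMatrix.apply, Pi.zero_apply] at h1 h2
    simp [LinearMatrix.apply, mul_add, Finset.sum_add_distrib, h1, h2]
  smul_mem' := by
    rintro c s ⟨hs, hs'⟩
    refine ⟨fun j => (hs j).smul c, fun x => ?_⟩
    ext i
    have h1 := congrFun (hs' x) i
    simp only [LinearMatrix.apply, Pi.zero_apply] at h1
    simp [LinearMatrix.apply, ← Finset.smul_sum, h1]

/-- Restriction of sections of `V(a)` to a smaller open set. -/
def kernelRestrict {k : Type*} [Field k] {n p q : ℕ} (A : LinearMatrix k n p q) (a : ℤ)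
    {W U : Opens (ProjSpace k n)} (h : W ≤ U) :
    kernelSections A a U →ₗ[k] kernelSections A a W where
  toFun s := ⟨fun x => s.1 ⟨x.1, h x.2⟩, fun j => (s.2.1 j).restrict h, fun _ => s.2.2 _⟩
  map_add' _ _ := rfl
  map_smul' _ _ := rfl

/-! ### Cohomology of `V(a)`

The cohomology groups are those of the (ordered) Čech complex for the standard affine open cover
of `ℙⁿ` by the sets `D₊(x₀), …, D₊(xₙ)`. As `V(a)` is quasi-coherent, all finite intersections of
these sets are affine and `ℙⁿ` is separated, this is the sheaf cohomology of `V(a)`. -/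

/-- A choice of indices `i₀ < ⋯ < iₑ` in `{0, …, n}`. -/
abbrev Simplex (n e : ℕ) : Type := Fin (e + 1) ↪o Fin (n + 1)

/-- The face of a simplex that omits the `j`-th vertex. -/
def Simplex.face {n e : ℕ} (σ : Simplex n (e + 1)) (j : Fin (e + 2)) : Simplex n e :=
  (Fin.succAboveOrderEmb j).trans σ

/-- The open set `D₊(x_{i₀}) ∩ ⋯ ∩ D₊(x_{iₑ})`. -/
def Simplex.opens {n e : ℕ} (k : Type*) [Field k] (σ : Simplex n e) : Opens (ProjSpace k n) :=
  ⨅ v : Fin (e + 1), ProjectiveSpectrum.basicOpen (grading k n) (MvPolynomial.X (σ v))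

theorem Simplex.opens_le_face {k : Type*} [Field k] {n e : ℕ} (σ : Simplex n (e + 1))
    (j : Fin (e + 2)) : σ.opens k ≤ (σ.face j).opens k :=
  le_iInf fun v => iInf_le (fun v : Fin (e + 2) =>
    ProjectiveSpectrum.basicOpen (grading k n) (MvPolynomial.X (σ v))) (j.succAbove v)

instance {k : Type*} [Field k] {n p q : ℕ} (A : LinearMatrix k n p q) (a : ℤ)
    (U : Opens (ProjSpace k n)) : AddCommGroup (kernelSections A a U) :=
  Submodule.addCommGroup _

/-- The Čech cochains of degree `e` with values in `V(a)`. -/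
def Cochain {k : Type*} [Field k] {n p q : ℕ} (A : LinearMatrix k n p q) (a : ℤ) (e : ℕ) :
    Type _ :=
  (σ : Simplex n e) → kernelSections A a (σ.opens k)

instance {k : Type*} [Field k] {n p q : ℕ} (A : LinearMatrix k n p q) (a : ℤ) (e : ℕ) :
    AddCommGroup (Cochain A a e) :=
  Pi.addCommGroup

instance {k : Type*} [Field k] {n p q : ℕ} (A : LinearMatrix k n p q) (a : ℤ) (e : ℕ) :
    Module k (Cochain A a e) :=
  Pi.module _ _ _

/-- The Čech differential `(ds)_σ = ∑ⱼ (-1)ʲ s_{∂ⱼσ}|_{U_σ}`. -/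
def cechD {k : Type*} [Field k] {n p q : ℕ} (A : LinearMatrix k n p q) (a : ℤ) (e : ℕ) :
    Cochain A a e →ₗ[k] Cochain A a (e + 1) where
  toFun s σ := ∑ j : Fin (e + 2),
    (-1 : k) ^ (j : ℕ) • kernelRestrict A a (σ.opens_le_face j) (s (σ.face j))
  map_add' s t := funext fun σ =>
    (Finset.sum_congr rfl fun (j : Fin (e + 2)) _ => (congrArg ((-1 : k) ^ (j : ℕ) • ·)
      (map_add (kernelRestrict A a (σ.opens_le_face j)) (s (σ.face j)) (t (σ.face j)))).trans
        (smul_add _ _ _)).trans Finset.sum_add_distrib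
  map_smul' c s := funext fun σ =>
    (Finset.sum_congr rfl fun (j : Fin (e + 2)) _ => (congrArg ((-1 : k) ^ (j : ℕ) • ·)
      (map_smul (kernelRestrict A a (σ.opens_le_face j)) c (s (σ.face j)))).trans
        (smul_comm _ _ _)).trans Finset.smul_sum.symm

theorem cechD_apply {k : Type*} [Field k] {n p q : ℕ} (A : LinearMatrix k n p q) (a : ℤ) (e : ℕ)
    (s : Cochain A a e) (σ : Simplex n (e + 1)) (x : σ.opens k) :
    (cechD A a e s σ).1 x = ∑ j : Fin (e + 2),
      (-1 : k) ^ (j : ℕ) • (s (σ.face j)).1 ⟨x.1, σ.opens_le_face j x.2⟩ := by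
  change (∑ j : Fin (e + 2),
    (-1 : k) ^ (j : ℕ) • kernelRestrict A a (σ.opens_le_face j) (s (σ.face j))).1 x = _
  rw [AddSubmonoidClass.coe_finsetSum, Finset.sum_apply]
  rfl

/-- The Čech differential squares to zero. -/
theorem cechD_comp_cechD {k : Type*} [Field k] {n p q : ℕ} (A : LinearMatrix k n p q) (a : ℤ)
    (e : ℕ) : (cechD A a (e + 1)).comp (cechD A a e) = 0 := by
  refine LinearMap.ext fun s => funext fun σ => Subtype.ext (funext fun x => ?_)
  have face_face : ∀ (j : Fin (e + 3)) (i : Fin (e + 2)),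
      (σ.face (j.succAbove i)).face (i.predAbove j) = (σ.face j).face i := fun j i => by
    refine RelEmbedding.ext fun l => congrArg σ ?_
    exact Fin.succAbove_succAbove_succAbove_predAbove j i l
  let F : Fin (e + 3) × Fin (e + 2) → Fin p → LocalRing k n x.1 := fun ji =>
    (s ((σ.face ji.1).face ji.2)).1
      ⟨x.1, Simplex.opens_le_face _ _ (Simplex.opens_le_face _ _ x.2)⟩
  have hF : ∀ j i, F (j.succAbove i, i.predAbove j) = F (j, i) := fun j i => by
    have key : ∀ (τ τ' : Simplex n e) (h : τ = τ') (hx : x.1 ∈ τ.opens k) (hx' : x.1 ∈ τ'.opens k),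
        (s τ).1 ⟨x.1, hx⟩ = (s τ').1 ⟨x.1, hx'⟩ := by
      rintro τ _ rfl _ _
      rfl
    exact key _ _ (face_face j i) _ _
  have hsum : ((cechD A a (e + 1)).comp (cechD A a e) s σ).1 x =
      ∑ ji : Fin (e + 3) × Fin (e + 2), (-1 : k) ^ ((ji.1 : ℕ) + (ji.2 : ℕ)) • F ji := by
    rw [Fintype.sum_prod_type]
    refine (cechD_apply A a (e + 1) (cechD A a e s) σ x).trans
      (Finset.sum_congr rfl fun j _ => ?_)
    rw [cechD_apply, Finset.smul_sum]
    simp only [pow_add, mul_smul, F]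
  refine hsum.trans (Finset.sum_involution
    (fun ji _ => (ji.1.succAbove ji.2, ji.2.predAbove ji.1)) ?_ ?_ ?_ ?_)
  · rintro ⟨j, i⟩ -
    simp only [hF, Fin.neg_one_pow_succAbove_add_predAbove]
    rw [← add_smul]
    simp
  · rintro ⟨j, i⟩ - - h
    exact Fin.succAbove_ne j i (congrArg Prod.fst h)
  · simp
  · rintro ⟨j, i⟩ -
    simp [Fin.succAbove_succAbove_predAbove, Fin.predAbove_predAbove_succAbove]

/-- The coboundaries in degree `e`. -/
def coboundaries {k : Type*} [Field k] {n p q : ℕ} (A : LinearMatrix k n p q) (a : ℤ) :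
    (e : ℕ) → Submodule k (Cochain A a e)
  | 0 => ⊥
  | e + 1 => LinearMap.range (cechD A a e)

/-- The cohomology group `Hᵉ(ℙⁿ, V(a))`: cocycles modulo coboundaries. -/
abbrev Cohomology {k : Type*} [Field k] {n p q : ℕ} (A : LinearMatrix k n p q) (a : ℤ) (e : ℕ) :
    Type _ :=
  LinearMap.ker (cechD A a e) ⧸
    (coboundaries A a e).comap (LinearMap.ker (cechD A a e)).subtype

/-- The kernel `V` of `O^p → O(1)^q` has natural cohomology: each twist `V(a)`, `a ∈ ℤ`, has at
most one nonvanishing cohomology group. -/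
def HasNaturalCohomology {k : Type*} [Field k] {n p q : ℕ} (A : LinearMatrix k n p q) : Prop :=
  ∀ (a : ℤ) (e e' : ℕ), Nontrivial (Cohomology A a e) → Nontrivial (Cohomology A a e') → e = e'

/-- `P` holds for a general point of the affine space `k^ι`: it holds at all points of some
nonempty Zariski open subset (equivalently, of some nonempty principal open subset). -/
def HoldsForGeneral {k ι : Type*} [Field k] (P : (ι → k) → Prop) : Prop :=
  ∃ f : MvPolynomial ι k, (∃ A : ι → k, MvPolynomial.eval A f ≠ 0) ∧
    ∀ A : ι → k, MvPolynomial.eval A f ≠ 0 → P A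

end SteinerBundle

end

/-! Write S for the coordinate ring, p = m(t+r), q = mt, N = dim S_a and N' = dim S_{a+1}. The
cohomology of V(a) is read off from 0 → V(a) → O(a)^p → O(a+1)^q → 0. By the vanishing theorems for
line bundles, only H^n can survive for a < -n and only H^1 for -n ≤ a < 0. For a ≥ 0, H^0 and H^1
are the kernel and cokernel of S_a^p → S_{a+1}^q. So it suffices that this map is injective or
surjective for every a ≥ 0 (`hasNaturalCohomology_of_injective_or_surjective`). Injectivity descends
to smaller degrees, surjectivity ascends to larger ones and also gives surjectivity of φ. Since α ≤
β + 1, only two degrees matter: injectivity for a = β - 1 (nothing if β = 0) and surjectivity for a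
= α - 1.

Maximal rank in one degree is the nonvanishing of a minor, which is a polynomial with integer
coefficients in the entries of the matrix. Hence one matrix of maximal rank over a large finite
field of suitable characteristic is enough (`exists_finite_field`).

Over a field F with Q elements such a matrix exists by a first moment count (`sum_card_ker_le`). A
tuple c in S_a^p whose components span U, with s = dim U and d = dim S_1 U, is killed by a
proportion Q^(-qd) of all matrices. There are at most Q^(ps) tuples spanning U and at most 2^s
Q^(s(N-s)) subspaces U of dimension s. If ps + s(N-s) ≤ qd + δ for all U, the kernel therefore has
average size at most 2^(N+1) Q^δ, and for Q > 2^(N+1) some kernel has dimension at most δ. Take δ =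
0 for injectivity and δ = pN - qN' for surjectivity.

The inequality on U comes from strict growth: d/s > N'/N for 0 ≠ U ≠ S_a (`finrank_mul_card_lt`).
Passing to leading monomials reduces this to a weighted double count of a set of monomials and its
multiples by variables (`card_mul_le_card_shadow`). As dN and sN' are integers, they differ by at
least 1. This surplus, multiplied by q or p, pays for s(N-s) ≤ N²/4, and this is where the lower
bound on m is needed. -/

noncomputable section

namespace SteinerBundle

/-! ### Leading indices of a space of functions -/

section Leads

variable {F M : Type*} [Field F] [Fintype M] [LinearOrder M]

open Classical in
/-- The indices at which the largest element of the support of some `f ∈ U` sits. -/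
def leads (U : Submodule F (M → F)) : Finset M :=
  Finset.univ.filter fun u => ∃ f ∈ U, f u ≠ 0 ∧ ∀ v, u < v → f v = 0

theorem mem_leads {U : Submodule F (M → F)} {u : M} :
    u ∈ leads U ↔ ∃ f ∈ U, f u ≠ 0 ∧ ∀ v, u < v → f v = 0 := by
  simp [leads]

/-- A nonzero element of `U` does not vanish at its own largest support index, so restriction to the
coordinates in `leads U` is injective. -/
theorem finrank_le_card_leads (U : Submodule F (M → F)) :
    Module.finrank F U ≤ (leads U).card := by
  classical
  let φ : U →ₗ[F] (leads U → F) := (LinearMap.funLeft F F Subtype.val).comp U.subtype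
  have hφ : Function.Injective φ := by
    rw [injective_iff_map_eq_zero]
    rintro ⟨f, hf⟩ h
    by_contra hne
    have hf0 : f ≠ 0 := fun h => hne (Subtype.ext h)
    obtain ⟨u₀, hu₀⟩ := Function.ne_iff.mp hf0
    obtain ⟨u, hu, hmax⟩ := (Finset.univ.filter fun u => f u ≠ 0).exists_max_image id
      ⟨u₀, by simpa using hu₀⟩
    have hul : u ∈ leads U := mem_leads.mpr ⟨f, hf, by simpa using hu, fun v hv => by
      by_contra hv'
      exact absurd (hmax v (by simpa using hv')) (not_le.mpr hv)⟩
    have := congrFun h ⟨u, hul⟩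
    exact (Finset.mem_filter.mp hu).2 this
  simpa using LinearMap.finrank_le_finrank_of_injective hφ

/-- Elements with distinct leading indices are independent: in a relation, at the largest index with
nonzero coefficient only one term contributes. -/
theorem card_leads_le_finrank (U : Submodule F (M → F)) :
    (leads U).card ≤ Module.finrank F U := by
  classical
  choose g hgU hg0 hgv using fun u : leads U => mem_leads.mp u.2
  have hli : LinearIndependent F (fun u => (⟨g u, hgU u⟩ : U)) := by
    rw [Fintype.linearIndependent_iff]
    intro c hc
    by_contra! hne
    obtain ⟨u₀, hu₀⟩ := hne
    obtain ⟨u, hu, hmax⟩ := (Finset.univ.filter fun u => c u ≠ 0).exists_max_image id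
      ⟨u₀, by simpa using hu₀⟩
    have h := congrFun (congrArg Subtype.val hc) u.1
    simp only [AddSubmonoidClass.coe_finsetSum, Finset.sum_apply, SetLike.val_smul,
      Pi.smul_apply, smul_eq_mul, ZeroMemClass.coe_zero, Pi.zero_apply] at h
    rw [Finset.sum_eq_single u] at h
    · exact (mul_ne_zero (by simpa using hu) (hg0 u)) h
    · intro v _ hvu
      by_cases hcv : c v = 0
      · simp [hcv]
      · have hle : v ≤ u := hmax v (by simpa using hcv)
        rw [hgv v u.1 (lt_of_le_of_ne hle fun h => hvu (Subtype.ext h)), mul_zero]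
    · simp
  simpa using hli.fintype_card_le_finrank

end Leads

/-! ### Shifting functions along injections of the index sets -/

section Shift

variable {F L M M' : Type*} [Field F] [Fintype M]

/-- Push functions forward along `ε l`. -/
def shift (F : Type*) [Field F] [DecidableEq M'] (ε : L → M → M') (l : L) : (M → F) →ₗ[F] (M' → F) :=
  Matrix.mulVecLin (Matrix.of fun v u => if ε l u = v then 1 else 0)

theorem shift_apply [DecidableEq M'] (ε : L → M → M') (l : L) (f : M → F) (v : M') :
    shift F ε l f v = ∑ u, if ε l u = v then f u else 0 := by
  simp [shift, Matrix.mulVec, dotProduct]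

/-- The span of all shifts of elements of `U`. -/
def expand [DecidableEq M'] (ε : L → M → M') (U : Submodule F (M → F)) : Submodule F (M' → F) :=
  ⨆ l, U.map (shift F ε l)

variable [Fintype L] [Fintype M'] [LinearOrder M] [LinearOrder M']

/-- A strictly monotone shift carries leading index to leading index. This bounds the dimension of
`expand ε U` from below by a purely combinatorial quantity. -/
theorem image_leads_subset (ε : L → M → M') (hε : ∀ l, StrictMono (ε l))
    (U : Submodule F (M → F)) :
    (Finset.univ.biUnion fun l => (leads U).image (ε l)) ⊆ leads (expand ε U) := by
  intro v hv
  simp only [Finset.mem_biUnion, Finset.mem_univ, true_and, Finset.mem_image] at hv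
  obtain ⟨l, u, hu, rfl⟩ := hv
  obtain ⟨f, hf, hfu, hfv⟩ := mem_leads.mp hu
  refine mem_leads.mpr ⟨shift F ε l f,
    (le_iSup (fun l => U.map (shift F ε l)) l) (Submodule.mem_map_of_mem hf), ?_, ?_⟩
  · rw [shift_apply, Finset.sum_eq_single u]
    · simpa using hfu
    · intro w _ hw
      rw [if_neg fun h => hw ((hε l).injective h)]
    · simp
  · intro v hv
    rw [shift_apply]
    refine Finset.sum_eq_zero fun w _ => ?_
    split_ifs with h
    · subst h
      exact hfv w ((hε l).lt_iff_lt.mp hv)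
    · rfl

theorem card_image_leads_le (ε : L → M → M') (hε : ∀ l, StrictMono (ε l))
    (U : Submodule F (M → F)) :
    (Finset.univ.biUnion fun l => (leads U).image (ε l)).card ≤
      Module.finrank F (expand ε U) :=
  (Finset.card_le_card (image_leads_subset ε hε U)).trans (card_leads_le_finrank _)

end Shift

/-! ### Subspaces of a finite vector space -/

section Subspaces

variable {F V : Type*} [Field F] [Fintype F] [AddCommGroup V] [Module F V] [Finite V]

/-- The product counts ordered bases of an s-dimensional space; each factor is at least half of Q^s
because i < s. -/
theorem pow_le_two_pow_mul_prod (Q s : ℕ) (hQ : 2 ≤ Q) :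
    Q ^ (s * s) ≤ 2 ^ s * ∏ i : Fin s, (Q ^ s - Q ^ (i : ℕ)) := by
  have h : ∏ _i : Fin s, Q ^ s ≤ ∏ i : Fin s, 2 * (Q ^ s - Q ^ (i : ℕ)) := by
    refine Finset.prod_le_prod' fun i _ => ?_
    have h1 : 2 * Q ^ (i : ℕ) ≤ Q ^ s :=
      calc 2 * Q ^ (i : ℕ) ≤ Q * Q ^ (i : ℕ) := by gcongr
        _ = Q ^ ((i : ℕ) + 1) := by ring
        _ ≤ Q ^ s := Nat.pow_le_pow_right (by omega) i.2
    omega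
  simpa [Finset.prod_mul_distrib, ← pow_mul] using h

/-- The number of subspaces of dimension `s` is at most `2 ^ s * Q ^ (s * (dim V - s))`. -/
theorem card_subspaces_le (s : ℕ) :
    Nat.card {U : Submodule F V // Module.finrank F U = s} * Fintype.card F ^ (s * s) ≤
      2 ^ s * Fintype.card F ^ (s * Module.finrank F V) := by
  classical
  set Q := Fintype.card F with hQ
  have : Finite (Submodule F V) :=
    Finite.of_injective (fun U : Submodule F V => (U : Set V)) SetLike.coe_injective
  have : Fintype V := Fintype.ofFinite V
  have hQ2 : 2 ≤ Q := Fintype.one_lt_card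
  -- A pair of a subspace and an ordered basis of it is determined by the basis as a tuple in `V`,
  -- since the subspace is its span.
  let Φ : (Σ U : {U : Submodule F V // Module.finrank F U = s},
      {v : Fin s → U.1 // LinearIndependent F v}) → (Fin s → V) := fun x i => (x.2.1 i : V)
  have hΦ : Function.Injective Φ := by
    have key : ∀ x, Submodule.span F (Set.range (Φ x)) = x.1.1 := by
      rintro ⟨⟨U, hU⟩, v, hv⟩
      have h := hv.span_eq_top_of_card_eq_finrank' (by simp [hU])
      have h2 : Set.range (Φ ⟨⟨U, hU⟩, v, hv⟩) = U.subtype '' Set.range v := by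
        rw [← Set.range_comp]; rfl
      rw [h2, ← Submodule.map_span, h, Submodule.map_top, Submodule.range_subtype]
    rintro x y hxy
    have h1 : x.1 = y.1 := Subtype.ext (by rw [← key x, hxy, key y])
    obtain ⟨U, v, hv⟩ := x
    obtain ⟨U', v', hv'⟩ := y
    obtain rfl : U = U' := h1
    have : v = v' := funext fun i => Subtype.ext (congrFun hxy i)
    subst this
    rfl
  have hcard := Nat.card_le_card_of_injective Φ hΦ
  have hfib : ∀ U : {U : Submodule F V // Module.finrank F U = s},
      Nat.card {v : Fin s → U.1 // LinearIndependent F v} =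
        ∏ i : Fin s, (Q ^ s - Q ^ (i : ℕ)) := fun U => by
    have := card_linearIndependent (K := F) (V := U.1) (k := s) U.2.ge
    rw [this, U.2, hQ]
  have : Fintype {U : Submodule F V // Module.finrank F U = s} := Fintype.ofFinite _
  rw [Nat.card_sigma, Finset.sum_congr rfl fun U _ => hfib U, Finset.sum_const, Finset.card_univ,
    Nat.card_fun, Nat.card_fin, smul_eq_mul, Nat.card_eq_fintype_card (α := V),
    Module.card_eq_pow_finrank (K := F) (V := V), ← hQ, ← pow_mul] at hcard
  rw [Nat.card_eq_fintype_card]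
  calc _ ≤ Fintype.card {U : Submodule F V // Module.finrank F U = s} *
        (2 ^ s * ∏ i : Fin s, (Q ^ s - Q ^ (i : ℕ))) := by
        gcongr; exact pow_le_two_pow_mul_prod Q s hQ2
    _ = 2 ^ s * (Fintype.card {U : Submodule F V // Module.finrank F U = s} *
        ∏ i : Fin s, (Q ^ s - Q ^ (i : ℕ))) := by ring
    _ ≤ _ := by rw [mul_comm s]; gcongr

end Subspaces

/-! ### Matrices of linear forms acting on coefficient vectors -/

section Coefficients

variable {R L M M' : Type*} [Fintype L] [Fintype M] [DecidableEq M'] {p q : ℕ}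

/-- The matrix of the map `(M → R)^p → (M' → R)^q` induced by `q × p` matrices `A(·,·,l)` and
shifts along `ε l`. -/
def coeffMatrix [CommRing R] (ε : L → M → M') (A : Fin q × Fin p × L → R) :
    Matrix (Fin q × M') (Fin p × M) R :=
  Matrix.of fun iv ju => ∑ l, if ε l ju.2 = iv.2 then A (iv.1, ju.1, l) else 0

variable [Field R]

/-- The map sending a row of a matrix of linear forms to its value at `c`. -/
def rowMap (ε : L → M → M') (c : Fin p × M → R) : (Fin p × L → R) →ₗ[R] (M' → R) :=
  Fintype.linearCombination R fun jl : Fin p × L => shift R ε jl.2 fun u => c (jl.1, u)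

/-- The i-th output depends only on the i-th row of `A`, so killing `c` is q independent copies of
one linear condition. -/
theorem coeffMatrix_mulVec (ε : L → M → M') (A : Fin q × Fin p × L → R) (c : Fin p × M → R)
    (i : Fin q) (v : M') :
    (coeffMatrix ε A).mulVec c (i, v) = rowMap ε c (fun jl => A (i, jl)) v := by
  simp only [Matrix.mulVec, dotProduct, coeffMatrix, Matrix.of_apply, rowMap,
    Fintype.linearCombination_apply, Finset.sum_apply, Pi.smul_apply, shift_apply, smul_eq_mul,
    Fintype.sum_prod_type, Finset.sum_mul, Finset.mul_sum]
  refine Finset.sum_congr rfl fun j _ => ?_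
  rw [Finset.sum_comm]
  refine Finset.sum_congr rfl fun l _ => Finset.sum_congr rfl fun u _ => ?_
  split_ifs <;> simp

/-- The span of the components of a tuple of vectors. -/
def tupleSpan (c : Fin p × M → R) : Submodule R (M → R) :=
  Submodule.span R (Set.range fun j u => c (j, u))

/-- The number of conditions imposed by `c` depends only on the span of its components. This is what
allows the count to be grouped by subspaces. -/
theorem range_rowMap (ε : L → M → M') (c : Fin p × M → R) :
    LinearMap.range (rowMap ε c) = expand ε (tupleSpan c) := by
  rw [rowMap, Fintype.range_linearCombination, expand]
  apply le_antisymm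
  · rw [Submodule.span_le]
    rintro _ ⟨⟨j, l⟩, rfl⟩
    exact (le_iSup (fun l => (tupleSpan c).map (shift R ε l)) l)
      (Submodule.mem_map_of_mem (Submodule.subset_span ⟨j, rfl⟩))
  · refine iSup_le fun l => ?_
    rw [tupleSpan, Submodule.map_span, Submodule.span_le]
    rintro _ ⟨_, ⟨j, rfl⟩, rfl⟩
    exact Submodule.subset_span ⟨(j, l), rfl⟩

end Coefficients

section Counting

variable {F L M M' : Type*} [Field F] [Fintype F] [Fintype L] [Fintype M]
  [DecidableEq M'] {p q : ℕ}

/-- For a fixed tuple `c`, the number of matrices of linear forms that annihilate it. -/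
theorem card_annihilating (ε : L → M → M') (c : Fin p × M → F) :
    Nat.card {A : Fin q × Fin p × L → F // (coeffMatrix ε A).mulVec c = 0} *
        Fintype.card F ^ (q * Module.finrank F (expand ε (tupleSpan c))) =
      Fintype.card F ^ (q * (p * Fintype.card L)) := by
  let e : {A : Fin q × Fin p × L → F // (coeffMatrix ε A).mulVec c = 0} ≃
      (Fin q → LinearMap.ker (rowMap ε c)) :=
    { toFun := fun A i => ⟨fun jl => A.1 (i, jl), by
        rw [LinearMap.mem_ker]
        funext v
        rw [← coeffMatrix_mulVec, A.2]
        rfl⟩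
      invFun := fun b => ⟨fun ijl => (b ijl.1).1 ijl.2, by
        funext ⟨i, v⟩
        rw [coeffMatrix_mulVec]
        exact congrFun (LinearMap.mem_ker.mp (b i).2) v⟩
      left_inv := fun A => rfl
      right_inv := fun b => rfl }
  have h := LinearMap.finrank_range_add_finrank_ker (rowMap ε c)
  rw [range_rowMap, Module.finrank_fintype_fun_eq_card, Fintype.card_prod, Fintype.card_fin] at h
  rw [Nat.card_congr e, Nat.card_fun, Nat.card_fin,
    Module.natCard_eq_pow_finrank (K := F), Nat.card_eq_fintype_card, ← pow_mul, ← pow_add, ← h]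
  ring_nf

variable [DecidableEq L]

/-- The first moment bound: the average size of the kernel of `coeffMatrix ε A`. -/
theorem sum_card_ker_le (ε : L → M → M') (δ : ℕ)
    (hδ : ∀ U : Submodule F (M → F),
      p * Module.finrank F U + Module.finrank F U * (Fintype.card M - Module.finrank F U) ≤
        q * Module.finrank F (expand ε U) + δ) :
    ∑ A : Fin q × Fin p × L → F, Nat.card {c // (coeffMatrix ε A).mulVec c = 0} ≤
      2 ^ (Fintype.card M + 1) *
        (Fintype.card F ^ (q * (p * Fintype.card L)) * Fintype.card F ^ δ) := by
  classical
  set Q := Fintype.card F with hQ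
  set N := Fintype.card M with hN
  set P := q * (p * Fintype.card L) with hP
  have hQ0 : 0 < Q := Fintype.card_pos
  have : Finite (Submodule F (M → F)) :=
    Finite.of_injective (fun U : Submodule F (M → F) => (U : Set (M → F))) SetLike.coe_injective
  have : Fintype (Submodule F (M → F)) := Fintype.ofFinite _
  have hsN : ∀ U : Submodule F (M → F), Module.finrank F U ≤ N := fun U => by
    simpa using U.finrank_le
  -- exchange the order of counting
  have hswap : ∑ A : Fin q × Fin p × L → F, Nat.card {c // (coeffMatrix ε A).mulVec c = 0} =
      ∑ c : Fin p × M → F,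
        Nat.card {A : Fin q × Fin p × L → F // (coeffMatrix ε A).mulVec c = 0} := by
    rw [← Nat.card_sigma, ← Nat.card_sigma]
    exact Nat.card_congr
      { toFun := fun x => ⟨x.2.1, x.1, x.2.2⟩
        invFun := fun x => ⟨x.2.1, x.1, x.2.2⟩
        left_inv := fun _ => rfl
        right_inv := fun _ => rfl }
  -- tuples spanning a given subspace
  have htuple : ∀ U : Submodule F (M → F),
      (Finset.univ.filter fun c : Fin p × M → F => tupleSpan c = U).card ≤
        Q ^ (p * Module.finrank F U) := fun U => by
    let g : {c : Fin p × M → F // tupleSpan c = U} → (Fin p → U) := fun c j =>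
      ⟨fun u => c.1 (j, u), by
        obtain ⟨c, rfl⟩ := c
        exact Submodule.subset_span ⟨j, rfl⟩⟩
    have hg : Function.Injective g := fun c c' h => Subtype.ext (funext fun ⟨j, u⟩ =>
      congrFun (congrArg Subtype.val (congrFun h j)) u)
    have := Nat.card_le_card_of_injective g hg
    rwa [Nat.card_fun, Nat.card_fin, Module.natCard_eq_pow_finrank (K := F) (V := U),
      Nat.card_eq_fintype_card, Nat.card_eq_fintype_card, ← pow_mul, Fintype.card_subtype,
      mul_comm] at this
  -- the contribution of a subspace
  have hU : ∀ U : Submodule F (M → F),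
      (∑ c ∈ Finset.univ.filter (fun c : Fin p × M → F => tupleSpan c = U),
        Nat.card {A : Fin q × Fin p × L → F // (coeffMatrix ε A).mulVec c = 0}) *
          Q ^ (Module.finrank F U * (N - Module.finrank F U)) ≤ Q ^ P * Q ^ δ := fun U => by
    have h1 : ∀ c ∈ Finset.univ.filter (fun c : Fin p × M → F => tupleSpan c = U),
        Nat.card {A : Fin q × Fin p × L → F // (coeffMatrix ε A).mulVec c = 0} *
          Q ^ (q * Module.finrank F (expand ε U)) ≤ Q ^ P := by
      intro c hc
      obtain rfl := (Finset.mem_filter.mp hc).2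
      exact (card_annihilating ε c).le
    have h2 := Finset.sum_le_sum h1
    rw [← Finset.sum_mul, Finset.sum_const, smul_eq_mul] at h2
    have h3 : 0 < Q ^ (q * Module.finrank F (expand ε U)) := pow_pos hQ0 _
    refine Nat.le_of_mul_le_mul_right ?_ h3
    calc _ = ((∑ c ∈ Finset.univ.filter (fun c : Fin p × M → F => tupleSpan c = U),
        Nat.card {A : Fin q × Fin p × L → F // (coeffMatrix ε A).mulVec c = 0}) *
          Q ^ (q * Module.finrank F (expand ε U))) *
          Q ^ (Module.finrank F U * (N - Module.finrank F U)) := by ring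
      _ ≤ (Q ^ (p * Module.finrank F U) * Q ^ P) *
          Q ^ (Module.finrank F U * (N - Module.finrank F U)) :=
          Nat.mul_le_mul_right _ (h2.trans (Nat.mul_le_mul_right _ (htuple U)))
      _ = Q ^ P * Q ^ (p * Module.finrank F U +
          Module.finrank F U * (N - Module.finrank F U)) := by rw [pow_add]; ring
      _ ≤ Q ^ P * Q ^ (q * Module.finrank F (expand ε U) + δ) := by
          exact Nat.mul_le_mul_left _ (Nat.pow_le_pow_right hQ0 (hδ U))
      _ = _ := by rw [pow_add]; ring
  -- the contribution of all subspaces of dimension `s`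
  have hs : ∀ s ∈ Finset.range (N + 1),
      ∑ U ∈ Finset.univ.filter (fun U : Submodule F (M → F) => Module.finrank F U = s),
        ∑ c ∈ Finset.univ.filter (fun c : Fin p × M → F => tupleSpan c = U),
          Nat.card {A : Fin q × Fin p × L → F // (coeffMatrix ε A).mulVec c = 0} ≤
        2 ^ s * (Q ^ P * Q ^ δ) := fun s hs => by
    have hsN' : s ≤ N := by simpa [Nat.lt_succ_iff] using hs
    have hcard := card_subspaces_le (F := F) (V := M → F) s
    rw [Module.finrank_fintype_fun_eq_card, Nat.card_eq_fintype_card, Fintype.card_subtype, ← hN,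
      ← hQ, show s * N = s * (N - s) + s * s by rw [← Nat.mul_add, Nat.sub_add_cancel hsN'],
      pow_add, ← mul_assoc] at hcard
    have hcard' := Nat.le_of_mul_le_mul_right hcard (pow_pos hQ0 _)
    have h1 : ∀ U ∈ Finset.univ.filter (fun U : Submodule F (M → F) => Module.finrank F U = s),
        (∑ c ∈ Finset.univ.filter (fun c : Fin p × M → F => tupleSpan c = U),
          Nat.card {A : Fin q × Fin p × L → F // (coeffMatrix ε A).mulVec c = 0}) *
          Q ^ (s * (N - s)) ≤ Q ^ P * Q ^ δ := by
      intro U hUs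
      obtain rfl := (Finset.mem_filter.mp hUs).2
      exact hU U
    have h2 := Finset.sum_le_sum h1
    rw [← Finset.sum_mul, Finset.sum_const, smul_eq_mul] at h2
    refine Nat.le_of_mul_le_mul_right (h2.trans ?_) (pow_pos hQ0 (s * (N - s)))
    calc _ ≤ (2 ^ s * Q ^ (s * (N - s))) * (Q ^ P * Q ^ δ) := Nat.mul_le_mul_right _ hcard'
      _ = _ := by ring
  rw [hswap, ← Finset.sum_fiberwise Finset.univ (fun c : Fin p × M → F => tupleSpan c),
    ← Finset.sum_fiberwise_of_maps_to (s := Finset.univ) (t := Finset.range (N + 1))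
      (g := fun U : Submodule F (M → F) => Module.finrank F U)
      (fun U _ => by simpa [Nat.lt_succ_iff] using hsN U)]
  refine (Finset.sum_le_sum hs).trans ?_
  rw [← Finset.sum_mul]
  gcongr
  -- The factors 2^s for s ≤ N add up to less than 2^(N+1).
  exact (Nat.geomSum_lt le_rfl (by simp)).le

/-- If every kernel had dimension at least δ + 1, the average kernel size would be at least Q^(δ+1),
which exceeds the first moment bound once Q > 2^(N+1). -/
theorem exists_finrank_ker_le (ε : L → M → M') (δ : ℕ)
    (hF : 2 ^ (Fintype.card M + 1) < Fintype.card F)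
    (hδ : ∀ U : Submodule F (M → F),
      p * Module.finrank F U + Module.finrank F U * (Fintype.card M - Module.finrank F U) ≤
        q * Module.finrank F (expand ε U) + δ) :
    ∃ A : Fin q × Fin p × L → F,
      Module.finrank F (LinearMap.ker (coeffMatrix ε A).mulVecLin) ≤ δ := by
  classical
  by_contra! hcon
  set Q := Fintype.card F with hQ
  have hQ1 : 1 < Q := Fintype.one_lt_card
  have h := sum_card_ker_le (p := p) (q := q) ε δ hδ
  have h2 : ∑ _A : Fin q × Fin p × L → F, Q ^ (δ + 1) ≤
      ∑ A : Fin q × Fin p × L → F, Nat.card {c // (coeffMatrix ε A).mulVec c = 0} := by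
    refine Finset.sum_le_sum fun A _ => ?_
    have : Nat.card {c // (coeffMatrix ε A).mulVec c = 0} =
        Nat.card (LinearMap.ker (coeffMatrix ε A).mulVecLin) := rfl
    rw [this, Module.natCard_eq_pow_finrank (K := F), Nat.card_eq_fintype_card]
    exact Nat.pow_le_pow_right hQ1.le (hcon A)
  have h3 := h2.trans h
  rw [Finset.sum_const, Finset.card_univ, smul_eq_mul, Fintype.card_fun, Fintype.card_prod,
    Fintype.card_prod, Fintype.card_fin, Fintype.card_fin, ← hQ] at h3
  have h4 : 0 < Q ^ (q * (p * Fintype.card L)) * Q ^ δ := by positivity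
  have h5 : Q * (Q ^ (q * (p * Fintype.card L)) * Q ^ δ) ≤
      2 ^ (Fintype.card M + 1) * (Q ^ (q * (p * Fintype.card L)) * Q ^ δ) := by
    refine le_trans (le_of_eq ?_) h3
    ring
  exact absurd (Nat.le_of_mul_le_mul_right h5 h4) (not_le.mpr hF)

end Counting

/-! ### Monomials and their shadows -/

/-- Exponents of the monomials of degree `a` in `n + 1` variables. -/
@[ext]
structure Mon (n a : ℕ) where
  /-- The exponents. -/
  exponents : Fin (n + 1) →₀ ℕ
  degree_eq : exponents.degree = a

section Monomials

variable {n a : ℕ}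

/-- Any monomial order would do; only compatibility with multiplication by a variable is used. -/
instance : LinearOrder (Mon n a) :=
  LinearOrder.lift' (fun u => toLex u.1) fun _ _ h => Mon.ext (toLex.injective h)

/-- Monomials of degree `a` as a finite set of exponents. -/
def Mon.equivAntidiag (n a : ℕ) :
    Mon n a ≃ (Finset.univ : Finset (Fin (n + 1))).finsuppAntidiag a where
  toFun u := ⟨u.1, by simp [Finset.mem_finsuppAntidiag, ← u.2, Finsupp.degree_eq_sum]⟩
  invFun u := ⟨u.1, by
    rw [Finsupp.degree_eq_sum, (Finset.mem_finsuppAntidiag.mp u.2).1]⟩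

instance : Fintype (Mon n a) := Fintype.ofEquiv _ (Mon.equivAntidiag n a).symm

theorem Mon.card (n a : ℕ) : Fintype.card (Mon n a) = (a + n).choose n := by
  rw [Fintype.card_congr (Mon.equivAntidiag n a), Fintype.card_coe,
    Finset.card_finsuppAntidiag_nat_eq_choose, Finset.card_fin,
    show n + 1 + a - 1 = n + a by omega, add_comm, Nat.choose_symm_add]

/-- The ratio N'/N equals (a+n+1)/(a+1), which is exactly the ratio produced by the double count of
shadows. -/
theorem Mon.card_succ (n a : ℕ) :
    Fintype.card (Mon n (a + 1)) * (a + 1) = Fintype.card (Mon n a) * (a + n + 1) := by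
  rw [Mon.card, Mon.card]
  have h := Nat.add_one_mul_choose_eq (a + n) a
  rw [← Nat.choose_symm_add, ← Nat.choose_symm_add (a := a)]
  rw [show a + 1 + n = a + n + 1 by ring]
  linarith

theorem Mon.sum_eq (u : Mon n a) : ∑ l, u.1 l = a := by
  rw [← Finsupp.degree_eq_sum, u.2]

/-- Multiplication of a monomial by the variable `l`. -/
def Mon.mul (l : Fin (n + 1)) (u : Mon n a) : Mon n (a + 1) :=
  ⟨u.1 + Finsupp.single l 1, by rw [map_add, u.2, Finsupp.degree_single]⟩

theorem Mon.mul_apply (l : Fin (n + 1)) (u : Mon n a) (i : Fin (n + 1)) :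
    (u.mul l).1 i = u.1 i + if l = i then 1 else 0 := by
  simp [Mon.mul, Finsupp.single_apply]

theorem Mon.mul_strictMono (l : Fin (n + 1)) : StrictMono (Mon.mul (a := a) l) := fun u v h => by
  change toLex (u.1 + Finsupp.single l 1) < toLex (v.1 + Finsupp.single l 1)
  exact add_lt_add_left (show toLex u.1 < toLex v.1 from h) (toLex (Finsupp.single l 1))

/-- The monomials obtained from a set of monomials by multiplication with a variable. -/
def shadow (B : Finset (Mon n a)) : Finset (Mon n (a + 1)) :=
  Finset.univ.biUnion fun l => B.image (Mon.mul l)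

theorem mul_mem_shadow {B : Finset (Mon n a)} {u : Mon n a} (hu : u ∈ B) (l : Fin (n + 1)) :
    u.mul l ∈ shadow B :=
  Finset.mem_biUnion.mpr ⟨l, Finset.mem_univ _, Finset.mem_image_of_mem _ hu⟩

/-- The graph in which monomials with a common multiple `x_i u = x_l w` are adjacent is
connected. -/
theorem Mon.mem_of_closed {B : Finset (Mon n a)}
    (hB : ∀ u ∈ B, ∀ w : Mon n a, ∀ i l, u.mul i = w.mul l → w ∈ B) {u w : Mon n a}
    (hu : u ∈ B) : w ∈ B := by
  -- The induction is on the total excess of `u` over `w` (truncated subtraction). Trading a factor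
  -- x_l with u_l > w_l for some x_i with u_i < w_i lowers it.
  induction hd : ∑ i, (u.1 i - w.1 i) using Nat.strong_induction_on generalizing u with
  | _ d ih =>
    by_cases h : ∀ l, u.1 l ≤ w.1 l
    · have : u = w := Mon.ext (Finsupp.ext fun l =>
        (Finset.sum_eq_sum_iff_of_le fun l _ => h l).mp (u.sum_eq.trans w.sum_eq.symm) l
          (Finset.mem_univ l))
      exact this ▸ hu
    · push Not at h
      obtain ⟨l, hl⟩ := h
      obtain ⟨i, hi⟩ : ∃ i, u.1 i < w.1 i := by
        by_contra! hcon
        have := (Finset.sum_eq_sum_iff_of_le fun l _ => hcon l).mp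
          (w.sum_eq.trans u.sum_eq.symm) l (Finset.mem_univ l)
        omega
      have hil : i ≠ l := by
        rintro rfl
        omega
      have hle : Finsupp.single l 1 ≤ u.1 + Finsupp.single i 1 := by
        rw [Finsupp.single_le_iff, Finsupp.add_apply]
        omega
      let u' : Mon n a := ⟨u.1 + Finsupp.single i 1 - Finsupp.single l 1, by
        have h1 := congrArg Finsupp.degree (tsub_add_cancel_of_le hle)
        rw [map_add, map_add, Finsupp.degree_single, Finsupp.degree_single, u.2] at h1
        omega⟩
      have hu'eq : u.mul i = u'.mul l := Mon.ext (tsub_add_cancel_of_le hle).symm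
      have hu'_apply : ∀ j, u'.1 j = u.1 j + (if i = j then 1 else 0) - if l = j then 1 else 0 :=
        fun j => by simp [u', Finsupp.single_apply]
      refine ih _ ?_ (hB u hu u' i l hu'eq) rfl
      rw [← hd]
      refine Finset.sum_lt_sum (fun j _ => ?_) ⟨l, Finset.mem_univ l, ?_⟩
      · rw [hu'_apply]
        by_cases hij : i = j
        · subst hij
          simp only [if_true]
          omega
        · simp only [if_neg hij]
          omega
      · rw [hu'_apply, if_neg hil, if_pos rfl]
        omega

/-- Give a pair (v, l) the exponent of x_l in v as weight. The injection (u, l) ↦ (x_l u, l) lands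
in pairs over the shadow; its image has weight ∑ (u_l + 1) = a + n + 1 for each u, while each v in
the shadow has total weight a + 1. If B is nonempty and proper, connectedness yields x_i u = x_l w
with u ∈ B and w ∉ B, and the pair (x_i u, l) has positive weight but is not in the image. -/
theorem card_mul_le_card_shadow (B : Finset (Mon n a)) :
    B.card * (a + n + 1) ≤ (shadow B).card * (a + 1) ∧
      (B.Nonempty → B ≠ Finset.univ → B.card * (a + n + 1) < (shadow B).card * (a + 1)) := by
  let g : Mon n a × Fin (n + 1) → Mon n (a + 1) × Fin (n + 1) := fun x => (x.1.mul x.2, x.2)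
  have hg : Function.Injective g := by
    rintro ⟨u, l⟩ ⟨u', l'⟩ h
    obtain rfl : l = l' := congrArg Prod.snd h
    exact Prod.ext ((Mon.mul_strictMono l).injective (congrArg Prod.fst h)) rfl
  have hsub : (B ×ˢ Finset.univ).image g ⊆ shadow B ×ˢ Finset.univ := by
    intro x hx
    obtain ⟨⟨u, l⟩, hu, rfl⟩ := Finset.mem_image.mp hx
    exact Finset.mem_product.mpr
      ⟨mul_mem_shadow (Finset.mem_product.mp hu).1 l, Finset.mem_univ _⟩
  have hL : ∑ x ∈ (B ×ˢ Finset.univ).image g, x.1.1 x.2 = B.card * (a + n + 1) := by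
    rw [Finset.sum_image hg.injOn, Finset.sum_product, Finset.sum_const_nat]
    intro u _
    simp only [g, Mon.mul_apply, if_true, Finset.sum_add_distrib, u.sum_eq]
    simp [add_assoc]
  have hR : ∑ x ∈ shadow B ×ˢ (Finset.univ : Finset (Fin (n + 1))), x.1.1 x.2 =
      (shadow B).card * (a + 1) := by
    rw [Finset.sum_product, Finset.sum_const_nat]
    exact fun u _ => u.sum_eq
  rw [← hL, ← hR]
  refine ⟨Finset.sum_le_sum_of_subset hsub, fun ⟨u₀, hu₀⟩ hne => ?_⟩
  have hex : ∃ u ∈ B, ∃ w : Mon n a, ∃ i l, u.mul i = w.mul l ∧ w ∉ B := by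
    by_contra! hcon
    exact hne (Finset.eq_univ_of_forall fun w => Mon.mem_of_closed hcon hu₀)
  obtain ⟨u, hu, w, i, l, hil, hw⟩ := hex
  refine Finset.sum_lt_sum_of_subset hsub (i := (u.mul i, l))
    (Finset.mem_product.mpr ⟨mul_mem_shadow hu i, Finset.mem_univ _⟩) ?_ ?_
    fun _ _ _ => Nat.zero_le _
  · intro hmem
    obtain ⟨⟨w', l'⟩, hw', heq⟩ := Finset.mem_image.mp hmem
    obtain rfl : l' = l := congrArg Prod.snd heq
    have : w'.mul l' = w.mul l' := (congrArg Prod.fst heq).trans hil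
    exact hw ((Mon.mul_strictMono l').injective this ▸ (Finset.mem_product.mp hw').1)
  · rw [hil, Mon.mul_apply]
    simp

end Monomials

/-! ### Growth of spaces of forms -/

section Growth

variable {F : Type*} [Field F] {n a : ℕ}

/-- The leading monomials of S_1 U contain the shadow of those of U, and leading monomials count
dimensions. -/
theorem finrank_mul_le (U : Submodule F (Mon n a → F)) :
    Module.finrank F U * (a + n + 1) ≤ Module.finrank F (expand Mon.mul U) * (a + 1) :=
  calc _ ≤ (leads U).card * (a + n + 1) := by gcongr; exact finrank_le_card_leads U
    _ ≤ (shadow (leads U)).card * (a + 1) := (card_mul_le_card_shadow _).1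
    _ ≤ _ := by gcongr; exact card_image_leads_le _ Mon.mul_strictMono U

theorem finrank_mul_lt (U : Submodule F (Mon n a → F)) (h0 : 0 < Module.finrank F U)
    (h1 : Module.finrank F U < Fintype.card (Mon n a)) :
    Module.finrank F U * (a + n + 1) < Module.finrank F (expand Mon.mul U) * (a + 1) :=
  calc _ ≤ (leads U).card * (a + n + 1) := by gcongr; exact finrank_le_card_leads U
    _ < (shadow (leads U)).card * (a + 1) := by
      refine (card_mul_le_card_shadow _).2 ?_ ?_
      · rw [← Finset.card_pos]
        exact h0.trans_le (finrank_le_card_leads U)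
      · intro h
        have := card_leads_le_finrank U
        rw [h, Finset.card_univ] at this
        omega
    _ ≤ _ := by gcongr; exact card_image_leads_le _ Mon.mul_strictMono U

theorem finrank_mul_card_lt (U : Submodule F (Mon n a → F)) (h0 : 0 < Module.finrank F U)
    (h1 : Module.finrank F U < Fintype.card (Mon n a)) :
    Module.finrank F U * Fintype.card (Mon n (a + 1)) <
      Module.finrank F (expand Mon.mul U) * Fintype.card (Mon n a) := by
  have h := finrank_mul_lt U h0 h1
  have hc := Mon.card_succ n a
  refine lt_of_mul_lt_mul_right (a := a + 1) ?_ (Nat.zero_le _)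
  calc _ = Fintype.card (Mon n a) * (Module.finrank F U * (a + n + 1)) := by
        rw [mul_assoc, hc]; ring
    _ < Fintype.card (Mon n a) * (Module.finrank F (expand Mon.mul U) * (a + 1)) :=
        Nat.mul_lt_mul_of_pos_left h (by omega)
    _ = _ := by ring

theorem finrank_mul_card_le (U : Submodule F (Mon n a → F)) :
    Module.finrank F U * Fintype.card (Mon n (a + 1)) ≤
      Module.finrank F (expand Mon.mul U) * Fintype.card (Mon n a) := by
  have h := finrank_mul_le U
  have hc := Mon.card_succ n a
  refine le_of_mul_le_mul_right (a := a + 1) ?_ (Nat.succ_pos _)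
  calc _ = Fintype.card (Mon n a) * (Module.finrank F U * (a + n + 1)) := by
        rw [mul_assoc, hc]; ring
    _ ≤ Fintype.card (Mon n a) * (Module.finrank F (expand Mon.mul U) * (a + 1)) :=
        Nat.mul_le_mul_left _ h
    _ = _ := by ring

end Growth

/-! ### Matrices of linear forms of maximal rank over finite fields -/

section Existence

variable {F : Type*} [Field F] [Fintype F] {n a p q : ℕ}

theorem four_mul_mul_sub_le {s N : ℕ} (h : s ≤ N) : 4 * (s * (N - s)) ≤ N ^ 2 := by
  obtain ⟨t, rfl⟩ := Nat.exists_eq_add_of_le h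
  rw [Nat.add_sub_cancel_left]
  nlinarith [sq_nonneg ((s : ℤ) - t)]

/-- For 0 < s < N, strict growth gives dN ≥ sN' + 1, so pN ≤ qN' implies qd - ps ≥ q/N ≥ N²/4 ≥
s(N-s). For s = N the term s(N-s) vanishes and weak growth suffices. -/
theorem exists_injective_of_finite
    (hF : 2 ^ (Fintype.card (Mon n a) + 1) < Fintype.card F)
    (hpq : p * Fintype.card (Mon n a) ≤ q * Fintype.card (Mon n (a + 1)))
    (hq : Fintype.card (Mon n a) ^ 3 ≤ 4 * q) :
    ∃ A : Fin q × Fin p × Fin (n + 1) → F,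
      Function.Injective (coeffMatrix (Mon.mul (a := a)) A).mulVec := by
  obtain ⟨A, hA⟩ := exists_finrank_ker_le (p := p) (q := q) (Mon.mul (n := n) (a := a)) 0 hF
    fun U => by
      set N := Fintype.card (Mon n a)
      set N' := Fintype.card (Mon n (a + 1))
      have hsN : Module.finrank F U ≤ N := by simpa using U.finrank_le
      have hlt := finrank_mul_card_lt U
      have hle := finrank_mul_card_le U
      set s := Module.finrank F U
      set d := Module.finrank F (expand Mon.mul U)
      rcases Nat.eq_zero_or_pos s with h0 | h0
      · simp [h0]
      have hN : 0 < N := h0.trans_le hsN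
      rw [add_zero]
      refine le_of_mul_le_mul_right (a := N) ?_ hN
      rcases hsN.eq_or_lt with h1 | h1
      · rw [h1, Nat.sub_self, mul_zero, add_zero]
        rw [h1] at hle
        calc p * N * N ≤ q * N' * N := Nat.mul_le_mul_right _ hpq
          _ = q * (N * N') := by ring
          _ ≤ q * (d * N) := Nat.mul_le_mul_left _ hle
          _ = _ := by ring
      · have h2 := hlt h0 h1
        have h3 := four_mul_mul_sub_le hsN
        have h4 : s * (N - s) * N ≤ q := by nlinarith
        calc (p * s + s * (N - s)) * N = s * (p * N) + s * (N - s) * N := by ring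
          _ ≤ s * (q * N') + q := add_le_add (Nat.mul_le_mul_left _ hpq) h4
          _ = q * (s * N' + 1) := by ring
          _ ≤ q * (d * N) := Nat.mul_le_mul_left _ h2
          _ = _ := by ring
  refine ⟨A, ?_⟩
  rw [Nat.le_zero, Submodule.finrank_eq_zero, LinearMap.ker_eq_bot] at hA
  exact hA

/-- By rank and nullity it is enough to bound the kernel by δ = pN - qN'. In terms of the
codimensions w = N - s and c = N' - d, strict growth reads wN' ≥ Nc + 1, whence pw - qc ≥ p/N' ≥
N²/4 ≥ s(N-s). -/
theorem exists_surjective_of_finite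
    (hF : 2 ^ (Fintype.card (Mon n a) + 1) < Fintype.card F)
    (hpq : q * Fintype.card (Mon n (a + 1)) ≤ p * Fintype.card (Mon n a))
    (hp : Fintype.card (Mon n a) ^ 2 * Fintype.card (Mon n (a + 1)) ≤ 4 * p) :
    ∃ A : Fin q × Fin p × Fin (n + 1) → F,
      Function.Surjective (coeffMatrix (Mon.mul (a := a)) A).mulVec := by
  obtain ⟨δ, hδ⟩ := Nat.exists_eq_add_of_le hpq
  obtain ⟨A, hA⟩ := exists_finrank_ker_le (p := p) (q := q) (Mon.mul (n := n) (a := a)) δ hF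
    fun U => by
      have hdN' : Module.finrank F (expand Mon.mul U) ≤ Fintype.card (Mon n (a + 1)) := by
        simpa using (expand (Mon.mul (n := n) (a := a)) U).finrank_le
      have hN' : 0 < Fintype.card (Mon n (a + 1)) := by
        rw [Mon.card]
        exact Nat.choose_pos (by omega)
      set N := Fintype.card (Mon n a)
      set N' := Fintype.card (Mon n (a + 1))
      have hsN : Module.finrank F U ≤ N := by simpa using U.finrank_le
      have hlt := finrank_mul_card_lt U
      have hle := finrank_mul_card_le U
      set s := Module.finrank F U
      set d := Module.finrank F (expand Mon.mul U)
      rcases Nat.eq_zero_or_pos s with h0 | h0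
      · simp [h0]
      have hN : 0 < N := h0.trans_le hsN
      rcases hsN.eq_or_lt with h1 | h1
      · rw [h1] at hle
        have : N' ≤ d := by nlinarith
        rw [h1, Nat.sub_self, mul_zero, add_zero, hδ]
        gcongr
      · have h2 : s * N' + 1 ≤ d * N := hlt h0 h1
        have h3 := four_mul_mul_sub_le hsN
        have h4 : s * (N - s) * N' ≤ p := by nlinarith
        obtain ⟨c, hc⟩ := Nat.exists_eq_add_of_le hdN'
        -- `N * c + 1 ≤ (N - s) * N'` bounds the codimension `c`
        obtain ⟨w, hw⟩ := Nat.exists_eq_add_of_le hsN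
        have h5 : N * c + 1 ≤ w * N' := by
          have : d * N + c * N = s * N' + w * N' := by rw [← add_mul, ← add_mul, ← hc, ← hw]; ring
          nlinarith
        have h6 : q * c + s * (N - s) ≤ p * w := by
          refine le_of_mul_le_mul_right (a := N') ?_ hN'
          calc (q * c + s * (N - s)) * N' = c * (q * N') + s * (N - s) * N' := by ring
            _ ≤ c * (p * N) + p := add_le_add (Nat.mul_le_mul_left _ hpq) h4
            _ = p * (N * c + 1) := by ring
            _ ≤ p * (w * N') := Nat.mul_le_mul_left _ h5
            _ = _ := by ring
        have h7 : p * N = p * s + p * w := by rw [← mul_add, ← hw]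
        have h8 : q * N' = q * d + q * c := by rw [← mul_add, ← hc]
        omega
  refine ⟨A, ?_⟩
  have h := LinearMap.finrank_range_add_finrank_ker (coeffMatrix (Mon.mul (a := a)) A).mulVecLin
  rw [Module.finrank_fintype_fun_eq_card, Fintype.card_prod, Fintype.card_fin, hδ] at h
  have htop : LinearMap.range (coeffMatrix (Mon.mul (a := a)) A).mulVecLin = ⊤ := by
    refine Submodule.eq_top_of_finrank_eq (le_antisymm (Submodule.finrank_le _) ?_)
    rw [Module.finrank_fintype_fun_eq_card, Fintype.card_prod, Fintype.card_fin]
    omega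
  exact LinearMap.range_eq_top.mp htop

end Existence

/-! ### Nonvanishing minors -/

section Minors

variable {K m m' : Type*} [Field K] [Fintype m']

/-- Some columns form a basis. A single minor thus certifies maximal rank, in a form that is
polynomial in the entries and can be moved between fields. -/
theorem exists_det_ne_zero_of_surjective [Fintype m] [DecidableEq m] {G : Matrix m m' K}
    (hG : Function.Surjective G.mulVec) :
    ∃ γ : m → m', (G.submatrix id γ).det ≠ 0 := by
  have hspan : Submodule.span K (Set.range G.col) = ⊤ := by
    rw [← Matrix.range_mulVecLin]
    exact LinearMap.range_eq_top.mpr hG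
  obtain ⟨f, hf, -, hli⟩ := Submodule.exists_fun_fin_finrank_span_eq K (Set.range G.col)
  choose γ hγ using hf
  have hcard : Fintype.card m = Module.finrank K (Submodule.span K (Set.range G.col)) := by
    rw [hspan, finrank_top, Module.finrank_fintype_fun_eq_card]
  let e := Fintype.equivFinOfCardEq hcard
  refine ⟨γ ∘ e, ?_⟩
  rw [← isUnit_iff_ne_zero, ← Matrix.isUnit_iff_isUnit_det,
    ← Matrix.linearIndependent_cols_iff_isUnit]
  have : (G.submatrix id (γ ∘ e)).col = f ∘ e := funext fun i => hγ (e i)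
  rw [this]
  exact hli.comp e e.injective

theorem exists_det_ne_zero_of_injective [Fintype m] [DecidableEq m] [DecidableEq m']
    {G : Matrix m m' K} (hG : Function.Injective G.mulVec) :
    ∃ ρ : m' → m, (G.submatrix ρ id).det ≠ 0 := by
  have hsurj : Function.Surjective G.transpose.mulVec := by
    rw [Matrix.mulVec_surjective_iff_exists_right_inverse]
    obtain ⟨L, hL⟩ := LinearMap.exists_leftInverse_of_injective G.mulVecLin
      (LinearMap.ker_eq_bot.mpr hG)
    refine ⟨(LinearMap.toMatrix' L).transpose, ?_⟩
    rw [← Matrix.transpose_mul, ← Matrix.transpose_one]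
    congr 1
    have := congrArg LinearMap.toMatrix' hL
    rwa [LinearMap.toMatrix'_comp, LinearMap.toMatrix'_id, ← Matrix.toLin'_apply',
      LinearMap.toMatrix'_toLin'] at this
  obtain ⟨ρ, hρ⟩ := exists_det_ne_zero_of_surjective hsurj
  refine ⟨ρ, ?_⟩
  rwa [← Matrix.transpose_submatrix, Matrix.det_transpose] at hρ

theorem surjective_of_det_ne_zero [Fintype m] [DecidableEq m] {G : Matrix m m' K} {γ : m → m'}
    (h : (G.submatrix id γ).det ≠ 0) : Function.Surjective G.mulVec := by
  have hu : IsUnit (G.submatrix id γ) := (Matrix.isUnit_iff_isUnit_det _).mpr h.isUnit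
  have hli := Matrix.linearIndependent_cols_iff_isUnit.mpr hu
  have htop := hli.span_eq_top_of_card_eq_finrank' (by simp)
  have : LinearMap.range G.mulVecLin = ⊤ := by
    rw [Matrix.range_mulVecLin, eq_top_iff, ← htop]
    apply Submodule.span_mono
    rintro _ ⟨i, rfl⟩
    exact ⟨γ i, rfl⟩
  exact LinearMap.range_eq_top.mp this

theorem injective_of_det_ne_zero [DecidableEq m'] {G : Matrix m m' K} {ρ : m' → m}
    (h : (G.submatrix ρ id).det ≠ 0) : Function.Injective G.mulVec := by
  have hinj : Function.Injective (G.submatrix ρ id).mulVec :=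
    Matrix.mulVec_injective_of_isUnit ((Matrix.isUnit_iff_isUnit_det _).mpr h.isUnit)
  intro v w hvw
  exact hinj (funext fun i => congrFun hvw (ρ i))

end Minors

/-! ### Transfer from finite fields -/

/-- In positive characteristic c both `k` and `F` contain the prime field, so an integer polynomial
vanishes over one iff its reduction mod c does. In characteristic zero an integer polynomial that
vanishes over `k` is already zero, and `F` may be any large prime field. -/
theorem exists_finite_field (k : Type*) [Field k] (B : ℕ) :
    ∃ (F : Type) (_ : Field F) (_ : Fintype F), B < Fintype.card F ∧
      ∀ {σ : Type} (D : MvPolynomial σ ℤ),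
        D.map (Int.castRingHom k) = 0 → D.map (Int.castRingHom F) = 0 := by
  obtain ⟨c, hc⟩ := CharP.exists k
  rcases CharP.char_is_prime_or_zero k c with hp | rfl
  · have : Fact c.Prime := ⟨hp⟩
    have hcard := GaloisField.card c _ (Nat.succ_ne_zero B)
    have : Finite (GaloisField c (B + 1)) :=
      Nat.finite_of_card_ne_zero (hcard ▸ pow_ne_zero _ hp.ne_zero)
    have : Fintype (GaloisField c (B + 1)) := Fintype.ofFinite _
    refine ⟨GaloisField c (B + 1), inferInstance, this, ?_, fun D hD => ?_⟩
    · rw [← Nat.card_eq_fintype_card, hcard]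
      exact (Nat.lt_succ_self B).trans (Nat.lt_pow_self hp.one_lt)
    · have h1 : Int.castRingHom k = (ZMod.castHom dvd_rfl k).comp (Int.castRingHom (ZMod c)) :=
        RingHom.ext_int _ _
      have h2 : Int.castRingHom (GaloisField c (B + 1)) =
          (algebraMap (ZMod c) (GaloisField c (B + 1))).comp (Int.castRingHom (ZMod c)) :=
        RingHom.ext_int _ _
      rw [h1, ← MvPolynomial.map_map] at hD
      rw [h2, ← MvPolynomial.map_map]
      have := MvPolynomial.map_injective _ (ZMod.castHom dvd_rfl k).injective
        (hD.trans (map_zero _).symm)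
      rw [this, map_zero]
  · have : CharZero k := CharP.charP_to_charZero k
    obtain ⟨ℓ, hℓ, hprime⟩ := Nat.exists_infinite_primes (B + 1)
    have : Fact ℓ.Prime := ⟨hprime⟩
    refine ⟨ZMod ℓ, inferInstance, inferInstance, ?_, fun D hD => ?_⟩
    · rw [ZMod.card]
      omega
    · have := MvPolynomial.map_injective (Int.castRingHom k) (RingHom.injective_int _)
        (hD.trans (map_zero _).symm)
      rw [this, map_zero]

section Generic

variable {n a p q : ℕ}

/-- The coefficient matrix with indeterminate coefficients. -/
def genericMatrix (n a p q : ℕ) :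
    Matrix (Fin q × Mon n (a + 1)) (Fin p × Mon n a)
      (MvPolynomial (Fin q × Fin p × Fin (n + 1)) ℤ) :=
  coeffMatrix Mon.mul MvPolynomial.X

theorem eval_genericMatrix {K : Type*} [Field K] (A : Fin q × Fin p × Fin (n + 1) → K) :
    (genericMatrix n a p q).map
        ((MvPolynomial.eval A).comp (MvPolynomial.map (Int.castRingHom K))) =
      coeffMatrix Mon.mul A := by
  ext iv ju
  simp only [genericMatrix, coeffMatrix, Matrix.map_apply, Matrix.of_apply, map_sum]
  refine Finset.sum_congr rfl fun l _ => ?_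
  split_ifs <;> simp

theorem eval_det_genericMatrix {K ι : Type*} [Field K] [Fintype ι] [DecidableEq ι]
    (A : Fin q × Fin p × Fin (n + 1) → K) (ρ : ι → Fin q × Mon n (a + 1))
    (γ : ι → Fin p × Mon n a) :
    MvPolynomial.eval A (MvPolynomial.map (Int.castRingHom K)
        ((genericMatrix n a p q).submatrix ρ γ).det) =
      ((coeffMatrix Mon.mul A).submatrix ρ γ).det := by
  rw [← eval_genericMatrix, ← RingHom.comp_apply, RingHom.map_det]
  rfl

variable (k : Type*) [Field k]

theorem exists_open_injective
    (hpq : p * Fintype.card (Mon n a) ≤ q * Fintype.card (Mon n (a + 1)))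
    (hq : Fintype.card (Mon n a) ^ 3 ≤ 4 * q) :
    ∃ f : MvPolynomial (Fin q × Fin p × Fin (n + 1)) k, f ≠ 0 ∧
      ∀ A, MvPolynomial.eval A f ≠ 0 →
        Function.Injective (coeffMatrix (Mon.mul (a := a)) A).mulVec := by
  obtain ⟨F, _, _, hF, hD⟩ := exists_finite_field k (2 ^ (Fintype.card (Mon n a) + 1))
  obtain ⟨A₀, hA₀⟩ := exists_injective_of_finite (F := F) hF hpq hq
  obtain ⟨ρ, hρ⟩ := exists_det_ne_zero_of_injective hA₀
  refine ⟨MvPolynomial.map (Int.castRingHom k) ((genericMatrix n a p q).submatrix ρ id).det,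
    fun h0 => hρ ?_, fun A hA => injective_of_det_ne_zero (ρ := ρ) ?_⟩
  · rw [← eval_det_genericMatrix, hD _ h0, map_zero]
  · rwa [eval_det_genericMatrix] at hA

theorem exists_open_surjective
    (hpq : q * Fintype.card (Mon n (a + 1)) ≤ p * Fintype.card (Mon n a))
    (hp : Fintype.card (Mon n a) ^ 2 * Fintype.card (Mon n (a + 1)) ≤ 4 * p) :
    ∃ f : MvPolynomial (Fin q × Fin p × Fin (n + 1)) k, f ≠ 0 ∧
      ∀ A, MvPolynomial.eval A f ≠ 0 →
        Function.Surjective (coeffMatrix (Mon.mul (a := a)) A).mulVec := by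
  obtain ⟨F, _, _, hF, hD⟩ := exists_finite_field k (2 ^ (Fintype.card (Mon n a) + 1))
  obtain ⟨A₀, hA₀⟩ := exists_surjective_of_finite (F := F) hF hpq hp
  obtain ⟨γ, hγ⟩ := exists_det_ne_zero_of_surjective hA₀
  refine ⟨MvPolynomial.map (Int.castRingHom k) ((genericMatrix n a p q).submatrix id γ).det,
    fun h0 => hγ ?_, fun A hA => surjective_of_det_ne_zero (γ := γ) ?_⟩
  · rw [← eval_det_genericMatrix, hD _ h0, map_zero]
  · rwa [eval_det_genericMatrix] at hA

end Generic

/-! ### The action on tuples of forms -/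

section Forms

variable {k : Type*} [Field k] {n a p q : ℕ}

/-- The form with given coefficients. -/
def toForm (k : Type*) [Field k] (n a : ℕ) : (Mon n a → k) →ₗ[k] CoordRing k n :=
  Fintype.linearCombination k fun u : Mon n a => MvPolynomial.monomial u.1 (1 : k)

theorem toForm_apply (c : Mon n a → k) :
    toForm k n a c = ∑ u, MvPolynomial.monomial u.1 (c u) := by
  simp [toForm, Fintype.linearCombination_apply, MvPolynomial.smul_monomial]

theorem toForm_mem (c : Mon n a → k) : toForm k n a c ∈ grading k n a := by
  rw [toForm_apply]
  exact Submodule.sum_mem _ fun u _ => MvPolynomial.isHomogeneous_monomial _ u.2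

theorem coeff_toForm (c : Mon n a → k) (u : Mon n a) :
    MvPolynomial.coeff u.1 (toForm k n a c) = c u := by
  classical
  rw [toForm_apply, MvPolynomial.coeff_sum, Finset.sum_eq_single u]
  · simp
  · intro v _ hv
    rw [MvPolynomial.coeff_monomial, if_neg fun h => hv (Mon.ext h)]
  · simp

theorem toForm_coeff {g : CoordRing k n} (hg : g ∈ grading k n a) :
    toForm k n a (fun u => MvPolynomial.coeff u.1 g) = g := by
  ext w
  by_cases hw : w.degree = a
  · exact coeff_toForm _ (⟨w, hw⟩ : Mon n a)
  · rw [MvPolynomial.IsHomogeneous.coeff_eq_zero (toForm_mem _) hw,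
      MvPolynomial.IsHomogeneous.coeff_eq_zero hg hw]

theorem X_mul_toForm (l : Fin (n + 1)) (c : Mon n a → k) :
    MvPolynomial.X l * toForm k n a c = toForm k n (a + 1) (shift k Mon.mul l c) := by
  rw [toForm_apply, toForm_apply, Finset.mul_sum]
  simp only [shift_apply, map_sum]
  rw [Finset.sum_comm]
  refine Finset.sum_congr rfl fun u _ => ?_
  rw [Finset.sum_eq_single (u.mul l), if_pos rfl]
  · rw [MvPolynomial.X, MvPolynomial.monomial_mul, one_mul, add_comm _ u.1]
    rfl
  · intro v _ hv
    rw [if_neg hv.symm, map_zero]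
  · simp

/-- This identifies `coeffMatrix` with the map S_a^p → S_{a+1}^q in the monomial bases. -/
theorem sum_entry_mul_toForm (A : LinearMatrix k n p q) (c : Fin p × Mon n a → k) (i : Fin q) :
    ∑ j, A.entry i j * toForm k n a (fun u => c (j, u)) =
      toForm k n (a + 1) fun v => (coeffMatrix Mon.mul A).mulVec c (i, v) := by
  simp only [coeffMatrix_mulVec]
  change _ = toForm k n (a + 1) (rowMap Mon.mul c fun jl => A (i, jl))
  rw [rowMap, Fintype.linearCombination_apply, map_sum, Fintype.sum_prod_type]
  refine Finset.sum_congr rfl fun j _ => ?_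
  rw [LinearMatrix.entry, Finset.sum_mul]
  refine Finset.sum_congr rfl fun l _ => ?_
  rw [smul_mul_assoc, X_mul_toForm, map_smul]

theorem X_mul_mem {g : CoordRing k n} (hg : g ∈ grading k n a) (l : Fin (n + 1)) :
    MvPolynomial.X l * g ∈ grading k n (a + 1) := by
  have := SetLike.mul_mem_graded (A := grading k n) (MvPolynomial.isHomogeneous_X k l) hg
  rwa [add_comm 1 a] at this

/-- `S_a^p → S_{a+1}^q` is injective. -/
def LinearMatrix.InjectiveInDegree (A : LinearMatrix k n p q) (a : ℕ) : Prop :=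
  ∀ v : Fin p → CoordRing k n, (∀ j, v j ∈ grading k n a) →
    (∀ i, ∑ j, A.entry i j * v j = 0) → v = 0

/-- `S_a^p → S_{a+1}^q` is surjective. -/
def LinearMatrix.SurjectiveInDegree (A : LinearMatrix k n p q) (a : ℕ) : Prop :=
  ∀ w : Fin q → CoordRing k n, (∀ i, w i ∈ grading k n (a + 1)) →
    ∃ v : Fin p → CoordRing k n, (∀ j, v j ∈ grading k n a) ∧ ∀ i, ∑ j, A.entry i j * v j = w i

theorem LinearMatrix.injectiveInDegree_of_coeffMatrix {A : LinearMatrix k n p q}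
    (hA : Function.Injective (coeffMatrix (Mon.mul (a := a)) A).mulVec) :
    A.InjectiveInDegree a := by
  intro v hv h
  let c : Fin p × Mon n a → k := fun ju => MvPolynomial.coeff ju.2.1 (v ju.1)
  have hvc : ∀ j, toForm k n a (fun u => c (j, u)) = v j := fun j => toForm_coeff (hv j)
  have hc : c = 0 := by
    apply hA
    rw [Matrix.mulVec_zero]
    funext ⟨i, u⟩
    have := h i
    simp only [← hvc] at this
    rw [sum_entry_mul_toForm] at this
    rw [← coeff_toForm (fun v => (coeffMatrix Mon.mul A).mulVec c (i, v)) u, this]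
    simp
  funext j
  rw [← hvc, hc]
  exact map_zero (toForm k n a)

theorem LinearMatrix.surjectiveInDegree_of_coeffMatrix {A : LinearMatrix k n p q}
    (hA : Function.Surjective (coeffMatrix (Mon.mul (a := a)) A).mulVec) :
    A.SurjectiveInDegree a := by
  intro w hw
  obtain ⟨c, hc⟩ := hA fun iv => MvPolynomial.coeff iv.2.1 (w iv.1)
  refine ⟨fun j => toForm k n a fun u => c (j, u), fun j => toForm_mem _, fun i => ?_⟩
  rw [sum_entry_mul_toForm, hc, toForm_coeff (hw i)]

/-- Multiplication by x_0 embeds the kernel in degree a into the kernel in degree a + 1. -/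
theorem LinearMatrix.InjectiveInDegree.of_succ {A : LinearMatrix k n p q}
    (hA : A.InjectiveInDegree (a + 1)) : A.InjectiveInDegree a := by
  intro v hv h
  have h0 := hA (fun j => MvPolynomial.X 0 * v j)
    (fun j => X_mul_mem (hv j) 0)
    (fun i => by
      rw [← mul_zero (MvPolynomial.X 0), ← h i, Finset.mul_sum]
      exact Finset.sum_congr rfl fun j _ => by ring)
  funext j
  exact (mul_eq_zero.mp (congrFun h0 j)).resolve_left (MvPolynomial.X_ne_zero 0)

theorem LinearMatrix.InjectiveInDegree.of_le {A : LinearMatrix k n p q} {b : ℕ}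
    (hA : A.InjectiveInDegree b) (hab : a ≤ b) : A.InjectiveInDegree a := by
  induction b, hab using Nat.le_induction with
  | base => exact hA
  | succ b _ ih => exact ih hA.of_succ

/-- A form of positive degree is a combination of the variables. -/
theorem exists_eq_sum_X_mul {g : CoordRing k n} (hg : g ∈ grading k n (a + 1)) :
    ∃ h : Fin (n + 1) → CoordRing k n, (∀ l, h l ∈ grading k n a) ∧
      g = ∑ l, MvPolynomial.X l * h l := by
  have key : ∀ u : Mon n (a + 1), ∃ (l : Fin (n + 1)) (u' : Mon n a), u = u'.mul l := fun u => by
    obtain ⟨l, hl⟩ : ∃ l, u.1 l ≠ 0 := by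
      by_contra! h
      have := u.sum_eq
      simp [h] at this
    have hle : Finsupp.single l 1 ≤ u.1 := by
      rw [Finsupp.single_le_iff]
      omega
    refine ⟨l, ⟨u.1 - Finsupp.single l 1, ?_⟩, Mon.ext (tsub_add_cancel_of_le hle).symm⟩
    have h1 := congrArg Finsupp.degree (tsub_add_cancel_of_le hle)
    rw [map_add, Finsupp.degree_single, u.2] at h1
    omega
  choose l u' hu using key
  refine ⟨fun m => ∑ u : Mon n (a + 1), if l u = m then
    MvPolynomial.monomial (u' u).1 (MvPolynomial.coeff u.1 g) else 0, fun m => ?_, ?_⟩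
  · refine Submodule.sum_mem _ fun u _ => ?_
    split_ifs
    · exact MvPolynomial.isHomogeneous_monomial _ (u' u).2
    · exact Submodule.zero_mem _
  · conv_lhs => rw [← toForm_coeff hg, toForm_apply]
    simp only [Finset.mul_sum, mul_ite, mul_zero]
    rw [Finset.sum_comm]
    refine Finset.sum_congr rfl fun u _ => ?_
    rw [Finset.sum_ite_eq Finset.univ (l u), if_pos (Finset.mem_univ _), MvPolynomial.X,
      MvPolynomial.monomial_mul, one_mul, add_comm _ (u' u).1]
    exact congrArg (fun u' : Mon n (a + 1) =>
      MvPolynomial.monomial u'.1 (MvPolynomial.coeff u.1 g)) (hu u)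

/-- The target in degree a + 2 is generated by the variables times the target in degree a + 1, and
the map is S-linear. -/
theorem LinearMatrix.SurjectiveInDegree.succ {A : LinearMatrix k n p q}
    (hA : A.SurjectiveInDegree a) : A.SurjectiveInDegree (a + 1) := by
  intro w hw
  choose h hh hwh using fun i => exists_eq_sum_X_mul (hw i)
  choose v hv hvw using fun l => hA (fun i => h i l) fun i => hh i l
  refine ⟨fun j => ∑ l, MvPolynomial.X l * v l j,
    fun j => Submodule.sum_mem _ fun l _ => X_mul_mem (hv l j) l, fun i => ?_⟩
  rw [hwh i]
  simp only [Finset.mul_sum, ← hvw]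
  rw [Finset.sum_comm]
  exact Finset.sum_congr rfl fun l _ => Finset.sum_congr rfl fun j _ => by ring

theorem LinearMatrix.SurjectiveInDegree.of_le {A : LinearMatrix k n p q} {b : ℕ}
    (hA : A.SurjectiveInDegree a) (hab : a ≤ b) : A.SurjectiveInDegree b := by
  induction b, hab using Nat.le_induction with
  | base => exact hA
  | succ b _ ih => exact ih.succ

end Forms

/-! ### The contraction of the Čech complex onto a vertex -/

section Contraction

variable {n e : ℕ}

theorem Simplex.face_apply (σ : Simplex n (e + 1)) (j : Fin (e + 2)) (v : Fin (e + 1)) :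
    σ.face j v = σ (j.succAbove v) := rfl

theorem Simplex.face_face (σ : Simplex n (e + 2)) (j : Fin (e + 3)) (i : Fin (e + 2)) :
    (σ.face (j.succAbove i)).face (i.predAbove j) = (σ.face j).face i :=
  RelEmbedding.ext fun l => congrArg σ (Fin.succAbove_succAbove_succAbove_predAbove j i l)

theorem Simplex.range_eq_insert (σ : Simplex n (e + 1)) (j : Fin (e + 2)) :
    Set.range σ = insert (σ j) (Set.range (σ.face j)) := by
  have : Set.range (σ.face j) = σ '' Set.range j.succAbove := by
    rw [← Set.range_comp]
    rfl
  rw [this, ← Set.image_insert_eq, Fin.range_succAbove, Set.insert_eq, Set.union_compl_self, Set.image_univ]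

theorem Simplex.eq_of_face_eq {σ τ : Simplex n (e + 1)} {i j : Fin (e + 2)} (h : σ i = τ j)
    (hf : σ.face i = τ.face j) : σ = τ ∧ i = j := by
  have hστ : σ = τ := by
    rw [← OrderEmbedding.range_inj, σ.range_eq_insert i, τ.range_eq_insert j, h, hf]
  exact ⟨hστ, τ.injective (hστ ▸ h)⟩

theorem Simplex.exists_insert (τ : Simplex n e) {i : Fin (n + 1)} (hi : i ∉ Set.range τ) :
    ∃ (σ : Simplex n (e + 1)) (j : Fin (e + 2)), σ j = i ∧ σ.face j = τ := by
  classical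
  let T : Finset (Fin (n + 1)) := insert i (Finset.univ.image τ)
  have hT : T.card = e + 2 := by
    rw [Finset.card_insert_of_notMem (by simpa using hi),
      Finset.card_image_of_injective _ τ.injective, Finset.card_fin]
  let σ : Simplex n (e + 1) := T.orderEmbOfFin hT
  have hrange : Set.range σ = insert i (Set.range τ) := by
    rw [Finset.range_orderEmbOfFin]
    simp [T]
  obtain ⟨j, hj⟩ : i ∈ Set.range σ := hrange ▸ Set.mem_insert _ _
  refine ⟨σ, j, hj, ?_⟩
  rw [← OrderEmbedding.range_inj]
  have h1 := σ.range_eq_insert j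
  rw [hrange, hj] at h1
  have h2 : i ∉ Set.range (σ.face j) := by
    rintro ⟨v, hv⟩
    rw [Simplex.face_apply, ← hj] at hv
    exact Fin.succAbove_ne j v (σ.injective hv)
  rw [← Set.insert_sdiff_self_of_notMem h2, ← h1, Set.insert_sdiff_self_of_notMem hi]

variable {R : Type*} [CommRing R]

open Classical in
/-- The contracting homotopy of the Čech complex given by adding the vertex `i`. -/
def cone (i : Fin (n + 1)) (z : Simplex n (e + 1) → R) (τ : Simplex n e) : R :=
  if h : i ∈ Set.range τ then 0
  else (-1) ^ ((τ.exists_insert h).choose_spec.choose : ℕ) * z (τ.exists_insert h).choose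

theorem cone_of_mem {i : Fin (n + 1)} (z : Simplex n (e + 1) → R) {τ : Simplex n e}
    (h : i ∈ Set.range τ) : cone i z τ = 0 := dif_pos h

/-- A simplex is determined by a face and the opposite vertex, so the choice made in `cone` is
forced. -/
theorem cone_face (z : Simplex n (e + 1) → R) (σ : Simplex n (e + 1)) (j : Fin (e + 2)) :
    cone (σ j) z (σ.face j) = (-1) ^ (j : ℕ) * z σ := by
  have h : σ j ∉ Set.range (σ.face j) := by
    rintro ⟨v, hv⟩
    exact Fin.succAbove_ne j v (σ.injective hv)
  rw [cone, dif_neg h]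
  have hs := ((σ.face j).exists_insert h).choose_spec.choose_spec
  obtain ⟨h1, h2⟩ := Simplex.eq_of_face_eq hs.1 hs.2
  rw [h2, h1]

/-- If i is a vertex of σ, only the face opposite i contributes, since the cone vanishes on faces
containing i. Otherwise the identity is the cocycle condition on the simplex spanned by σ and i. -/
theorem sum_cone_face (i : Fin (n + 1)) (z : Simplex n (e + 1) → R)
    (hz : ∀ ρ : Simplex n (e + 2), ∑ m : Fin (e + 3), (-1) ^ (m : ℕ) * z (ρ.face m) = 0)
    (σ : Simplex n (e + 1)) :
    ∑ j : Fin (e + 2), (-1) ^ (j : ℕ) * cone i z (σ.face j) = z σ := by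
  by_cases hi : i ∈ Set.range σ
  · obtain ⟨j, rfl⟩ := hi
    rw [Finset.sum_eq_single j, cone_face, ← mul_assoc, ← mul_pow]
    · simp
    · intro m _ hm
      obtain ⟨v, hv⟩ := Fin.exists_succAbove_eq hm.symm
      rw [cone_of_mem z ⟨v, by rw [Simplex.face_apply, hv]⟩, mul_zero]
    · simp
  · obtain ⟨ρ, l, rfl, rfl⟩ := σ.exists_insert hi
    have hcone : ∀ j : Fin (e + 2), (-1) ^ (j : ℕ) * cone (ρ l) z ((ρ.face l).face j) =
        -(-1) ^ (l : ℕ) * ((-1) ^ (l.succAbove j : ℕ) * z (ρ.face (l.succAbove j))) := fun j => by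
      have h1 := cone_face z (ρ.face (l.succAbove j)) (j.predAbove l)
      rw [Simplex.face_face, Simplex.face_apply, Fin.succAbove_succAbove_predAbove] at h1
      have hs := Fin.neg_one_pow_succAbove_add_predAbove (R := R) l j
      rw [pow_add, pow_add] at hs
      have hj : (-1 : R) ^ (j : ℕ) * (-1) ^ (j : ℕ) = 1 := by rw [← mul_pow]; simp
      have hm : (-1 : R) ^ (l.succAbove j : ℕ) * (-1) ^ (l.succAbove j : ℕ) = 1 := by
        rw [← mul_pow]; simp
      rw [h1]
      calc _ = ((-1 : R) ^ (l.succAbove j : ℕ) * (-1) ^ (l.succAbove j : ℕ)) *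
            ((-1) ^ (j : ℕ) * ((-1) ^ (j.predAbove l : ℕ) * z (ρ.face (l.succAbove j)))) := by
            rw [hm, one_mul]
        _ = ((-1 : R) ^ (l.succAbove j : ℕ) * (-1) ^ (j.predAbove l : ℕ)) *
            ((-1) ^ (j : ℕ) * ((-1) ^ (l.succAbove j : ℕ) * z (ρ.face (l.succAbove j)))) := by ring
        _ = ((-1 : R) ^ (j : ℕ) * (-1) ^ (j : ℕ)) * (-(-1) ^ (l : ℕ) *
            ((-1) ^ (l.succAbove j : ℕ) * z (ρ.face (l.succAbove j)))) := by rw [hs]; ring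
        _ = _ := by rw [hj, one_mul]
    rw [Finset.sum_congr rfl fun j _ => hcone j, ← Finset.mul_sum]
    have h := hz ρ
    rw [Fin.sum_univ_succAbove _ l] at h
    have hl : (-1 : R) ^ (l : ℕ) * (-1) ^ (l : ℕ) = 1 := by rw [← mul_pow]; simp
    rw [eq_neg_of_add_eq_zero_right h]
    linear_combination z (ρ.face l) * hl

end Contraction

/-! ### Exactness of the Čech complex of monomials with bounded denominators -/

section MonomialExactness

variable {k : Type*} [Field k] {n e : ℕ}

/-- Polynomials of degree `D` all of whose monomials are divisible by `∏_{i ∉ T} x_i ^ N`. -/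
def boundedForms (k : Type*) [Field k] {n : ℕ} (T : Set (Fin (n + 1))) (N : ℕ) (D : ℤ) :
    Set (CoordRing k n) :=
  {c | ∀ u, MvPolynomial.coeff u c ≠ 0 → (u.degree : ℤ) = D ∧ ∀ i ∉ T, N ≤ u i}

/-- The complex splits over monomials. A monomial u is allowed on σ when u_i ≥ N for all i outside
σ; if u_i ≥ N for some i, adding or deleting the vertex i does not change whether u is allowed, so
coning onto i contracts the u-part within the allowed cochains. -/
theorem exists_cech_primitive (N : ℕ) (D : ℤ) (c : Simplex n (e + 1) → CoordRing k n)
    (hc : ∀ σ : Simplex n (e + 1), c σ ∈ boundedForms k (Set.range σ) N D)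
    (hN : ∀ σ u, MvPolynomial.coeff u (c σ) ≠ 0 → ∃ i, N ≤ u i)
    (hz : ∀ ρ : Simplex n (e + 2), ∑ m : Fin (e + 3), (-1) ^ (m : ℕ) * c (ρ.face m) = 0) :
    ∃ b : Simplex n e → CoordRing k n, (∀ τ : Simplex n e, b τ ∈ boundedForms k (Set.range τ) N D) ∧
      ∀ σ, ∑ j : Fin (e + 2), (-1) ^ (j : ℕ) * b (σ.face j) = c σ := by
  classical
  have hsign : ∀ (m : ℕ) (g : CoordRing k n) (u : Fin (n + 1) →₀ ℕ),
      MvPolynomial.coeff u ((-1) ^ m * g) = (-1) ^ m * MvPolynomial.coeff u g := fun m g u => by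
    rw [show (-1 : CoordRing k n) ^ m = MvPolynomial.C ((-1) ^ m) by simp,
      MvPolynomial.coeff_C_mul]
  let Z : (Fin (n + 1) →₀ ℕ) → Simplex n (e + 1) → k := fun u σ => MvPolynomial.coeff u (c σ)
  -- The cone vertex depends on u alone, not on σ. The default 0 is harmless: by `hN` such a u
  -- occurs in no `c σ`.
  let i₀ : (Fin (n + 1) →₀ ℕ) → Fin (n + 1) := fun u => if h : ∃ i, N ≤ u i then h.choose else 0
  have hi₀ : ∀ σ u, Z u σ ≠ 0 → N ≤ u (i₀ u) := fun σ u h => by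
    have := hN σ u h
    simp only [i₀, dif_pos this]
    exact this.choose_spec
  let B : Finset (Fin (n + 1) →₀ ℕ) := Finset.univ.biUnion fun σ => (c σ).support
  let b : Simplex n e → CoordRing k n := fun τ =>
    ∑ u ∈ B, MvPolynomial.monomial u (cone (i₀ u) (Z u) τ)
  have hb : ∀ τ u, MvPolynomial.coeff u (b τ) = cone (i₀ u) (Z u) τ := fun τ u => by
    simp only [b, MvPolynomial.coeff_sum, MvPolynomial.coeff_monomial]
    rw [Finset.sum_ite_eq' B u]
    split_ifs with hu
    · rfl
    · have hZ : Z u = 0 := funext fun σ => by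
        by_contra h
        exact hu (Finset.mem_biUnion.mpr
          ⟨σ, Finset.mem_univ _, MvPolynomial.mem_support_iff.mpr h⟩)
      rw [cone]
      split_ifs <;> simp [hZ]
  refine ⟨b, fun τ u hu => ?_, fun σ => ?_⟩
  · rw [hb] at hu
    by_cases hmem : i₀ u ∈ Set.range τ
    · exact absurd (cone_of_mem _ hmem) hu
    · obtain ⟨σ, j, hσj, rfl⟩ := τ.exists_insert hmem
      rw [← hσj, cone_face] at hu
      have hu' : Z u σ ≠ 0 := right_ne_zero_of_mul hu
      refine ⟨(hc σ u hu').1, fun i hi => ?_⟩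
      by_cases hii : i = i₀ u
      · exact hii ▸ hi₀ σ u hu'
      · refine (hc σ u hu').2 i ?_
        rw [σ.range_eq_insert j, Set.mem_insert_iff, hσj]
        tauto
  · ext u
    rw [MvPolynomial.coeff_sum]
    simp only [hsign, hb]
    refine sum_cone_face (i₀ u) (Z u) (fun ρ => ?_) σ
    have := congrArg (MvPolynomial.coeff u) (hz ρ)
    rw [MvPolynomial.coeff_sum] at this
    simpa only [hsign, MvPolynomial.coeff_zero] using this

end MonomialExactness

/-! ### Forms of integral degree and squarefree monomials -/

section IntegralDegree

variable {k : Type*} [Field k] {n : ℕ}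

/-- Forms of degree `D ∈ ℤ`; there are none but `0` if `D < 0`. -/
def forms (k : Type*) [Field k] (n : ℕ) (D : ℤ) : Submodule k (CoordRing k n) where
  carrier := {c | ∀ u, MvPolynomial.coeff u c ≠ 0 → (u.degree : ℤ) = D}
  zero_mem' u hu := absurd (MvPolynomial.coeff_zero u) hu
  add_mem' {c c'} hc hc' u hu := by
    by_cases h : MvPolynomial.coeff u c = 0
    · refine hc' u fun h' => hu ?_
      rw [MvPolynomial.coeff_add, h, h', add_zero]
    · exact hc u h
  smul_mem' r c hc u hu := hc u fun h => hu (by rw [MvPolynomial.coeff_smul, h, smul_zero])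

theorem mem_forms_natCast {i : ℕ} {c : CoordRing k n} :
    c ∈ forms k n i ↔ c ∈ grading k n i := by
  constructor
  · intro h
    exact (MvPolynomial.mem_homogeneousSubmodule i c).mpr fun u hu => by
      have : (u.degree : ℤ) = i := h u hu
      have hw : Finsupp.weight 1 u = u.degree := by
        simp only [Finsupp.degree_eq_weight_one]
        rfl
      rw [hw]
      exact_mod_cast this
  · intro h u hu
    by_contra hne
    exact hu (MvPolynomial.IsHomogeneous.coeff_eq_zero h fun h => hne (by exact_mod_cast h))

theorem eq_zero_of_mem_forms_neg {D : ℤ} (hD : D < 0) {c : CoordRing k n}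
    (hc : c ∈ forms k n D) : c = 0 := by
  ext u
  by_contra h
  have : (u.degree : ℤ) = D := hc u h
  omega

theorem mul_mem_forms {D D' : ℤ} {c c' : CoordRing k n} (hc : c ∈ forms k n D)
    (hc' : c' ∈ forms k n D') : c * c' ∈ forms k n (D + D') := by
  rcases lt_or_ge D 0 with h | h
  · rw [eq_zero_of_mem_forms_neg h hc, zero_mul]
    exact zero_mem _
  rcases lt_or_ge D' 0 with h' | h'
  · rw [eq_zero_of_mem_forms_neg h' hc', mul_zero]
    exact zero_mem _
  lift D to ℕ using h
  lift D' to ℕ using h'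
  rw [← Nat.cast_add, mem_forms_natCast]
  exact SetLike.mul_mem_graded (mem_forms_natCast.mp hc) (mem_forms_natCast.mp hc')

/-- The exponent of `∏_{i ∈ T} x_i`. -/
def indicatorExp {n : ℕ} (T : Finset (Fin (n + 1))) : Fin (n + 1) →₀ ℕ :=
  ∑ i ∈ T, Finsupp.single i 1

theorem indicatorExp_apply (T : Finset (Fin (n + 1))) (i : Fin (n + 1)) :
    indicatorExp T i = if i ∈ T then 1 else 0 := by
  classical
  simp [indicatorExp, Finsupp.finsetSum_apply, Finsupp.single_apply]

theorem degree_indicatorExp (T : Finset (Fin (n + 1))) : (indicatorExp T).degree = T.card := by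
  simp [indicatorExp]

/-- The monomial `∏_{i ∈ T} x_i ^ N`. -/
def vprod (k : Type*) [Field k] {n : ℕ} (T : Finset (Fin (n + 1))) (N : ℕ) : CoordRing k n :=
  MvPolynomial.monomial (N • indicatorExp T) 1

theorem vprod_eq_pow (T : Finset (Fin (n + 1))) (N : ℕ) :
    vprod k T N = (∏ i ∈ T, MvPolynomial.X i) ^ N := by
  have h : ∏ i ∈ T, MvPolynomial.X i = MvPolynomial.monomial (indicatorExp T) (1 : k) :=
    (MvPolynomial.monomial_sum_one T fun i => Finsupp.single i 1).symm
  rw [h, MvPolynomial.monomial_pow, one_pow]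
  rfl

theorem vprod_ne_zero (T : Finset (Fin (n + 1))) (N : ℕ) : vprod k T N ≠ 0 := by
  rw [vprod, Ne, MvPolynomial.monomial_eq_zero]
  exact one_ne_zero

theorem vprod_add (T : Finset (Fin (n + 1))) (N N' : ℕ) :
    vprod k T (N + N') = vprod k T N * vprod k T N' := by
  simp only [vprod_eq_pow, pow_add]

theorem vprod_mem_forms (T : Finset (Fin (n + 1))) (N : ℕ) :
    vprod k T N ∈ forms k n (N * T.card) := by
  rw [← Nat.cast_mul, mem_forms_natCast]
  refine MvPolynomial.isHomogeneous_monomial _ ?_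
  rw [map_nsmul, degree_indicatorExp, smul_eq_mul]

theorem vprod_mul_sdiff {T T' : Finset (Fin (n + 1))} (h : T ⊆ T') (N : ℕ) :
    vprod k T N * vprod k (T' \ T) N = vprod k T' N := by
  rw [vprod_eq_pow, vprod_eq_pow, vprod_eq_pow, ← mul_pow, mul_comm, Finset.prod_sdiff h]

end IntegralDegree

/-! ### Fractions with denominators supported on a set of variables -/

section Fractions

variable {k : Type*} [Field k] {n : ℕ}

/-- The field of fractions of the coordinate ring. -/
abbrev FunField (k : Type*) [Field k] (n : ℕ) : Type _ := FractionRing (CoordRing k n)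

theorem algebraMap_funField_injective :
    Function.Injective (algebraMap (CoordRing k n) (FunField k n)) :=
  IsFractionRing.injective _ _

theorem algebraMap_vprod_ne_zero (T : Finset (Fin (n + 1))) (N : ℕ) :
    algebraMap (CoordRing k n) (FunField k n) (vprod k T N) ≠ 0 :=
  (map_ne_zero_iff _ algebraMap_funField_injective).mpr (vprod_ne_zero T N)

/-- `κ` is the fraction `c / ∏_{i ∈ T} x_i ^ N` with `c` a form, homogeneous of degree `d`. -/
def HasDenominator (T : Finset (Fin (n + 1))) (d : ℤ) (κ : FunField k n) (N : ℕ) : Prop :=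
  ∃ c ∈ forms k n (N * T.card + d),
    κ * algebraMap (CoordRing k n) (FunField k n) (vprod k T N) = algebraMap _ _ c

theorem HasDenominator.of_le {T : Finset (Fin (n + 1))} {d : ℤ} {κ : FunField k n} {N N' : ℕ}
    (h : HasDenominator T d κ N) (hN : N ≤ N') : HasDenominator T d κ N' := by
  obtain ⟨m, rfl⟩ := Nat.exists_eq_add_of_le hN
  obtain ⟨c, hc, hκ⟩ := h
  refine ⟨c * vprod k T m, ?_, ?_⟩
  · have := mul_mem_forms hc (vprod_mem_forms T m)
    convert this using 2
    push_cast
    ring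
  · rw [vprod_add, map_mul, ← mul_assoc, hκ, map_mul]

/-- Fractions of degree `d` whose denominator is a power of `∏_{i ∈ T} x_i`. -/
def twistFractions (k : Type*) [Field k] {n : ℕ} (T : Finset (Fin (n + 1))) (d : ℤ) :
    AddSubgroup (FunField k n) where
  carrier := {κ | ∃ N, HasDenominator T d κ N}
  zero_mem' := ⟨0, 0, zero_mem _, by simp⟩
  add_mem' := by
    rintro κ κ' ⟨N, h⟩ ⟨N', h'⟩
    obtain ⟨c, hc, hκ⟩ := h.of_le (le_max_left N N')
    obtain ⟨c', hc', hκ'⟩ := h'.of_le (le_max_right N N')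
    exact ⟨max N N', c + c', add_mem hc hc', by rw [add_mul, hκ, hκ', map_add]⟩
  neg_mem' := by
    rintro κ ⟨N, c, hc, hκ⟩
    exact ⟨N, -c, neg_mem hc, by rw [neg_mul, hκ, map_neg]⟩

theorem exists_common_denominator {ι : Type*} [Finite ι] {T : ι → Finset (Fin (n + 1))} {d : ℤ}
    {κ : ι → FunField k n} (h : ∀ i, κ i ∈ twistFractions k (T i) d) (M : ℕ) :
    ∃ N, M ≤ N ∧ ∀ i, HasDenominator (T i) d (κ i) N := by
  have := Fintype.ofFinite ι
  choose N hN using h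
  exact ⟨M + ∑ i, N i, Nat.le_add_right _ _, fun i => (hN i).of_le
    ((Finset.single_le_sum (fun _ _ => Nat.zero_le _) (Finset.mem_univ i)).trans
      (Nat.le_add_left _ _))⟩

theorem twistFractions_mono {T T' : Finset (Fin (n + 1))} (h : T ⊆ T') (d : ℤ) :
    twistFractions k T d ≤ twistFractions k T' d := by
  rintro κ ⟨N, c, hc, hκ⟩
  refine ⟨N, c * vprod k (T' \ T) N, ?_, ?_⟩
  · have := mul_mem_forms hc (vprod_mem_forms (T' \ T) N)
    convert this using 2
    rw [← Finset.card_sdiff_add_card_eq_card h]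
    push_cast
    ring
  · rw [← vprod_mul_sdiff h, map_mul, ← mul_assoc, hκ, map_mul]

theorem algebraMap_mul_mem_twistFractions {T : Finset (Fin (n + 1))} {d D : ℤ}
    {g : CoordRing k n} (hg : g ∈ forms k n D) {κ : FunField k n}
    (hκ : κ ∈ twistFractions k T d) :
    algebraMap _ _ g * κ ∈ twistFractions k T (d + D) := by
  obtain ⟨N, c, hc, h⟩ := hκ
  refine ⟨N, g * c, ?_, by rw [mul_assoc, h, map_mul]⟩
  have := mul_mem_forms hg hc
  convert this using 2
  ring

theorem neg_one_pow_mul_mem {T : Finset (Fin (n + 1))} {d : ℤ} {κ : FunField k n}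
    (hκ : κ ∈ twistFractions k T d) (m : ℕ) : (-1) ^ m * κ ∈ twistFractions k T d := by
  rcases neg_one_pow_eq_or (FunField k n) m with h | h
  · rwa [h, one_mul]
  · rw [h, neg_one_mul]
    exact neg_mem hκ

/-- Over the common denominator (x_0 ⋯ x_n)^N, having poles only along T means that the numerator is
divisible by x_i^N for each i outside T. -/
theorem HasDenominator.exists_boundedForm {T : Finset (Fin (n + 1))} {d : ℤ} {κ : FunField k n}
    {N : ℕ} (h : HasDenominator T d κ N) :
    ∃ c ∈ boundedForms k (T : Set (Fin (n + 1))) N (N * (n + 1) + d),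
      κ * algebraMap (CoordRing k n) (FunField k n) (vprod k Finset.univ N) =
        algebraMap _ _ c := by
  obtain ⟨c, hc, hκ⟩ := h
  refine ⟨c * vprod k (Finset.univ \ T) N, fun u hu => ⟨?_, fun i hi => ?_⟩, ?_⟩
  · have := mul_mem_forms hc (vprod_mem_forms (Finset.univ \ T) N) u hu
    rw [this]
    have h1 := Finset.card_sdiff_add_card_eq_card (Finset.subset_univ T)
    rw [Finset.card_fin] at h1
    have h2 : ((Finset.univ \ T).card : ℤ) + T.card = n + 1 := by exact_mod_cast h1
    linear_combination (N : ℤ) * h2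
  · rw [vprod, MvPolynomial.coeff_mul_monomial'] at hu
    have hle : N • indicatorExp (Finset.univ \ T) ≤ u := by
      by_contra hcon
      exact hu (if_neg hcon)
    have := hle i
    rw [Finsupp.smul_apply, indicatorExp_apply,
      if_pos (by simpa using hi)] at this
    simpa using this
  · rw [← vprod_mul_sdiff (Finset.subset_univ T), map_mul, ← mul_assoc, hκ, map_mul]

theorem mem_twistFractions_of_boundedForm {T : Finset (Fin (n + 1))} {d : ℤ} {κ : FunField k n}
    {N : ℕ} {c : CoordRing k n}
    (hc : c ∈ boundedForms k (T : Set (Fin (n + 1))) N (N * (n + 1) + d))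
    (hκ : κ * algebraMap (CoordRing k n) (FunField k n) (vprod k Finset.univ N) =
      algebraMap _ _ c) : κ ∈ twistFractions k T d := by
  set μ := N • indicatorExp (Finset.univ \ T) with hμ
  have hμu : ∀ u ∈ c.support, μ ≤ u := fun u hu i => by
    rw [hμ, Finsupp.smul_apply, indicatorExp_apply]
    split_ifs with hi
    · simpa using (hc u (MvPolynomial.mem_support_iff.mp hu)).2 i (by simpa using hi)
    · simp
  let c' : CoordRing k n :=
    ∑ u ∈ c.support, MvPolynomial.monomial (u - μ) (MvPolynomial.coeff u c)
  have hcc' : c = c' * vprod k (Finset.univ \ T) N := by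
    conv_lhs => rw [c.as_sum]
    rw [Finset.sum_mul]
    refine Finset.sum_congr rfl fun u hu => ?_
    rw [vprod, MvPolynomial.monomial_mul, mul_one, tsub_add_cancel_of_le (hμu u hu)]
  have hcard : ((Finset.univ \ T).card : ℤ) + T.card = n + 1 := by
    have h1 := Finset.card_sdiff_add_card_eq_card (Finset.subset_univ T)
    rw [Finset.card_fin] at h1
    exact_mod_cast h1
  refine ⟨N, c', Submodule.sum_mem _ fun u hu => fun w hw => ?_, ?_⟩
  · rw [MvPolynomial.coeff_monomial] at hw
    obtain rfl : u - μ = w := by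
      by_contra h
      exact hw (if_neg h)
    have h1 := congrArg Finsupp.degree (tsub_add_cancel_of_le (hμu u hu))
    rw [map_add, hμ, map_nsmul, degree_indicatorExp, smul_eq_mul, ← hμ] at h1
    have h2 := (hc u (MvPolynomial.mem_support_iff.mp hu)).1
    rw [← h1] at h2
    push_cast at h2
    linear_combination h2 - (N : ℤ) * hcard
  · refine mul_right_cancel₀ (algebraMap_vprod_ne_zero (Finset.univ \ T) N) ?_
    rw [mul_assoc, ← map_mul, ← map_mul, vprod_mul_sdiff (Finset.subset_univ T), hκ, ← hcc']

/-- A fraction that is regular away from the intersection of two different hyperplanes is a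
form. -/
theorem exists_form_of_mem_twistFractions {T T' : Finset (Fin (n + 1))} (hT : Disjoint T T')
    {d : ℤ} {κ : FunField k n} (h : κ ∈ twistFractions k T d) (h' : κ ∈ twistFractions k T' d) :
    ∃ g ∈ forms k n d, κ = algebraMap _ _ g := by
  obtain ⟨N, h⟩ := h
  obtain ⟨N', h'⟩ := h'
  obtain ⟨c, hc, hκ⟩ := (h.of_le (le_max_left N N')).exists_boundedForm
  obtain ⟨c', hc', hκ'⟩ := (h'.of_le (le_max_right N N')).exists_boundedForm
  obtain rfl : c = c' := algebraMap_funField_injective (hκ.symm.trans hκ')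
  -- Each variable lies outside T or outside T', so its N-th power divides the common numerator and
  -- the whole denominator cancels.
  have hempty : κ ∈ twistFractions k (∅ : Finset (Fin (n + 1))) d := by
    refine mem_twistFractions_of_boundedForm (fun u hu => ⟨(hc u hu).1, fun i _ => ?_⟩) hκ
    by_cases hi : i ∈ T
    · exact (hc' u hu).2 i fun hi' => Finset.disjoint_left.mp hT hi hi'
    · exact (hc u hu).2 i hi
  obtain ⟨M, g, hg, hM⟩ := hempty
  refine ⟨g, by simpa using hg, ?_⟩
  simpa [vprod_eq_pow] using hM

/-- The set of vertices of a simplex. -/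
def Simplex.verts {e : ℕ} (σ : Simplex n e) : Finset (Fin (n + 1)) :=
  Finset.univ.map σ.toEmbedding

theorem Simplex.coe_verts {e : ℕ} (σ : Simplex n e) :
    (σ.verts : Set (Fin (n + 1))) = Set.range σ := by
  simp [Simplex.verts]

theorem Simplex.card_verts {e : ℕ} (σ : Simplex n e) : σ.verts.card = e + 1 := by
  simp [Simplex.verts]

theorem Simplex.verts_face_subset {e : ℕ} (σ : Simplex n (e + 1)) (j : Fin (e + 2)) :
    (σ.face j).verts ⊆ σ.verts := by
  rw [← Finset.coe_subset, Simplex.coe_verts, Simplex.coe_verts, σ.range_eq_insert j]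
  exact Set.subset_insert _ _

/-- The Čech complex of `O(d)` is exact in degree `e + 1` if `e + 1 < n`, and everywhere in
positive degrees if `d ≥ -n`. -/
theorem exists_cech_primitive_fractions {e : ℕ} {d : ℤ} (hd : e + 1 < n ∨ -(n : ℤ) ≤ d)
    (z : Simplex n (e + 1) → FunField k n) (hz : ∀ σ, z σ ∈ twistFractions k σ.verts d)
    (hcoc : ∀ ρ : Simplex n (e + 2), ∑ m : Fin (e + 3), (-1) ^ (m : ℕ) * z (ρ.face m) = 0) :
    ∃ y : Simplex n e → FunField k n, (∀ τ, y τ ∈ twistFractions k τ.verts d) ∧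
      ∀ σ, ∑ j : Fin (e + 2), (-1) ^ (j : ℕ) * y (σ.face j) = z σ := by
  obtain ⟨N, -, hN⟩ := exists_common_denominator hz 0
  choose c hc hκ using fun σ => (hN σ).exists_boundedForm
  set P := algebraMap (CoordRing k n) (FunField k n) (vprod k Finset.univ N)
  have hP : P ≠ 0 := algebraMap_vprod_ne_zero _ _
  obtain ⟨b, hb, hbc⟩ := exists_cech_primitive N (N * (n + 1) + d) c
    (fun σ => by rw [← Simplex.coe_verts]; exact hc σ)
    (fun σ u hu => by
      -- Either σ, having e + 2 ≤ n vertices, misses some i, or all u_i ≤ N - 1 would force N(n+1) +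
      -- d ≤ (N-1)(n+1), that is d ≤ -n-1.
      rcases hd with hd | hd
      · obtain ⟨i, hi⟩ : ∃ i, i ∉ σ.verts := by
          by_contra! hall
          have := Finset.card_le_card (fun i _ => hall i : Finset.univ ⊆ σ.verts)
          rw [Finset.card_fin, Simplex.card_verts] at this
          omega
        exact ⟨i, (hc σ u hu).2 i hi⟩
      · by_contra! hall
        have h1 := (hc σ u hu).1
        rw [Finsupp.degree_eq_sum] at h1
        have h2 : ∑ i, (u i + 1) ≤ ∑ _i : Fin (n + 1), N :=
          Finset.sum_le_sum fun i _ => hall i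
        rw [Finset.sum_add_distrib] at h2
        simp only [Finset.sum_const, Finset.card_univ, Fintype.card_fin, smul_eq_mul,
          mul_one] at h2
        have h3 : ((∑ i, u i : ℕ) : ℤ) + (n + 1) ≤ (n + 1) * N := by exact_mod_cast h2
        nlinarith)
    (fun ρ => by
      apply algebraMap_funField_injective
      have := congrArg (· * P) (hcoc ρ)
      simp only [Finset.sum_mul, mul_assoc, zero_mul] at this
      rw [map_sum, map_zero, ← this]
      refine Finset.sum_congr rfl fun m _ => ?_
      rw [map_mul, ← hκ, map_pow, map_neg, map_one])
  refine ⟨fun τ => algebraMap _ _ (b τ) / P, fun τ => ?_, fun σ => ?_⟩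
  · refine mem_twistFractions_of_boundedForm (c := b τ) ?_ (div_mul_cancel₀ _ hP)
    rw [Simplex.coe_verts]
    exact hb τ
  · refine mul_right_cancel₀ hP ?_
    rw [hκ, ← hbc, Finset.sum_mul, map_sum]
    refine Finset.sum_congr rfl fun j _ => ?_
    rw [mul_assoc, div_mul_cancel₀ _ hP, map_mul, map_pow, map_neg, map_one]

end Fractions

/-! ### Germs as elements of the function field -/

section Germs

variable {k : Type*} [Field k] {n : ℕ}

/-- The embedding of the localization at `x` into the function field. -/
def germToFrac (x : ProjSpace k n) : LocalRing k n x →+* FunField k n :=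
  IsLocalization.lift (M := x.asHomogeneousIdeal.toIdeal.primeCompl)
    (g := algebraMap (CoordRing k n) (FunField k n)) fun y => by
      refine isUnit_iff_ne_zero.mpr
        ((map_ne_zero_iff _ algebraMap_funField_injective).mpr fun h => ?_)
      exact y.2 (h ▸ zero_mem _)

theorem germToFrac_algebraMap (x : ProjSpace k n) (g : CoordRing k n) :
    germToFrac x (algebraMap _ _ g) = algebraMap _ _ g :=
  IsLocalization.lift_eq _ g

theorem germToFrac_mk (x : ProjSpace k n) (g h : CoordRing k n)
    (hx : h ∉ x.asHomogeneousIdeal.toIdeal) :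
    germToFrac x (Localization.mk g ⟨h, hx⟩) * algebraMap _ _ h = algebraMap _ _ g := by
  rw [← germToFrac_algebraMap x h, ← map_mul, ← germToFrac_algebraMap x g]
  congr 1
  rw [Localization.mk_eq_mk']
  exact IsLocalization.mk'_spec (M := x.asHomogeneousIdeal.toIdeal.primeCompl) _ g ⟨h, hx⟩

theorem germToFrac_injective (x : ProjSpace k n) : Function.Injective (germToFrac x) := by
  rw [injective_iff_map_eq_zero]
  intro s hs
  induction s using Localization.induction_on with
  | H y =>
    obtain ⟨g, h, hx⟩ := y
    have := germToFrac_mk x g h hx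
    rw [hs, zero_mul, eq_comm, map_eq_zero_iff _ algebraMap_funField_injective] at this
    rw [this, Localization.mk_zero]

theorem germToFrac_smul (x : ProjSpace k n) (m : ℕ) (s : LocalRing k n x) :
    germToFrac x ((-1 : k) ^ m • s) = (-1) ^ m * germToFrac x s := by
  rcases Nat.even_or_odd m with h | h
  · rw [h.neg_one_pow, h.neg_one_pow, one_smul, one_mul]
  · rw [h.neg_one_pow, h.neg_one_pow, neg_one_mul, ← map_neg]
    exact congrArg _ (neg_one_smul k s)

/-- The generic point of projective space. -/
def genericPt (k : Type*) [Field k] (n : ℕ) : ProjSpace k n where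
  asHomogeneousIdeal := ⊥
  isPrime := by
    rw [HomogeneousIdeal.toIdeal_bot]
    exact Ideal.isPrime_bot
  not_irrelevant_le h := by
    have hX : (MvPolynomial.X 0 : CoordRing k n) ∈ grading k n 1 := MvPolynomial.isHomogeneous_X k 0
    have h0 : (MvPolynomial.X 0 : CoordRing k n) ∈ (⊥ : HomogeneousIdeal (grading k n)) :=
      (HomogeneousIdeal.irrelevant_le _).mp h 1 one_pos hX
    exact MvPolynomial.X_ne_zero (R := k) (0 : Fin (n + 1)) h0

theorem notMem_genericPt {f : CoordRing k n} (hf : f ≠ 0) :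
    f ∉ (genericPt k n).asHomogeneousIdeal.toIdeal := hf

theorem genericPt_mem {U : Opens (ProjSpace k n)} {x : ProjSpace k n} (hx : x ∈ U) :
    genericPt k n ∈ U := by
  obtain ⟨s, hs⟩ := (ProjectiveSpectrum.isOpen_iff _ _).mp U.2
  by_contra h
  have h1 : genericPt k n ∈ ProjectiveSpectrum.zeroLocus (grading k n) s := hs ▸ h
  have h2 : x ∈ ((U : Set (ProjSpace k n))ᶜ) := by
    change x ∈ U.carrierᶜ
    rw [hs]
    intro f hf
    have : f = 0 := h1 hf
    rw [this]
    exact zero_mem x.asHomogeneousIdeal.toIdeal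
  exact h2 hx

theorem exists_X_notMem (x : ProjSpace k n) :
    ∃ l, (MvPolynomial.X l : CoordRing k n) ∉ x.asHomogeneousIdeal.toIdeal := by
  by_contra! h
  obtain ⟨i, f, hi, hf, hfx⟩ := exists_homogeneous_notMem x
  obtain ⟨i, rfl⟩ := Nat.exists_eq_succ_of_ne_zero hi.ne'
  obtain ⟨g, -, rfl⟩ := exists_eq_sum_X_mul hf
  exact hfx (Ideal.sum_mem _ fun l _ => Ideal.mul_mem_right _ _ (h l))

end Germs

/-! ### Sections of `O(d)` as fractions -/

section Sections

variable {k : Type*} [Field k] {n : ℕ} {d : ℤ} {U : Opens (ProjSpace k n)}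

/-- The local fraction representing s near x is also valid at the generic point, which lies in every
nonempty open set. A section thus becomes a single element of the function field. -/
theorem IsTwistSection.germToFrac_eq {s : (x : U) → LocalRing k n x.1} (hs : IsTwistSection d s)
    (x y : U) : germToFrac x.1 (s x) = germToFrac y.1 (s y) := by
  have key : ∀ x : U, germToFrac x.1 (s x) =
      germToFrac (genericPt k n) (s ⟨genericPt k n, genericPt_mem x.2⟩) := by
    intro x
    obtain ⟨W, hW, hxW, i, j, g, h, hg, hh, hij, hfr⟩ := hs x
    obtain ⟨hx, e⟩ := hfr ⟨x.1, hxW⟩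
    obtain ⟨hη, eη⟩ := hfr ⟨genericPt k n, genericPt_mem hxW⟩
    have hh0 : algebraMap (CoordRing k n) (FunField k n) h ≠ 0 :=
      (map_ne_zero_iff _ algebraMap_funField_injective).mpr fun h0 => hx (h0 ▸ zero_mem _)
    refine mul_right_cancel₀ hh0 ?_
    change s x = _ at e
    change s ⟨genericPt k n, _⟩ = _ at eη
    rw [e, eη, germToFrac_mk, germToFrac_mk]
  rw [key x, key y]

/-- Sections of `O(d)` over the open set `f ≠ 0` have a power of `f` as denominator. -/
theorem IsTwistSection.exists_denominator {s : (x : U) → LocalRing k n x.1}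
    (hs : IsTwistSection d s) {f : CoordRing k n} {e : ℕ} (he : 0 < e) (hf : f ∈ grading k n e)
    (hU : ∀ x, x ∈ U ↔ f ∉ x.asHomogeneousIdeal.toIdeal) (x₀ : U) :
    ∃ N : ℕ, ∃ c ∈ forms k n (N * e + d),
      germToFrac x₀.1 (s x₀) * algebraMap _ _ f ^ N = algebraMap _ _ c := by
  obtain ⟨W, hW, hxW, i, j, g, h, hg, hh, hij, hfr⟩ := hs x₀
  obtain ⟨hx, e₀⟩ := hfr ⟨x₀.1, hxW⟩
  change s x₀ = _ at e₀
  have hh0 : h ≠ 0 := fun h0 => hx (h0 ▸ zero_mem _)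
  set κ := germToFrac x₀.1 (s x₀) with hκ
  have hκgh : κ * algebraMap _ _ h = algebraMap _ _ g := by
    rw [hκ, e₀]
    exact germToFrac_mk _ _ _ _
  -- the ideal of denominators
  let I : Ideal (CoordRing k n) :=
    Submodule.comap (LinearMap.mulRight (CoordRing k n) g) (Ideal.span {h})
  have hI : ∀ a, a ∈ I ↔ h ∣ a * g := fun a => Ideal.mem_span_singleton
  have hIhom : I.IsHomogeneous (grading k n) := by
    intro m a ha
    obtain ⟨b, hb⟩ := (hI a).mp ha
    refine (hI _).mpr ?_
    rw [← DirectSum.coe_decompose_mul_add_of_right_mem (grading k n) hg, hb, mul_comm h b]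
    by_cases hle : j ≤ m + i
    · obtain ⟨l, hl⟩ := Nat.exists_eq_add_of_le' hle
      rw [hl, DirectSum.coe_decompose_mul_add_of_right_mem (grading k n) hh]
      exact Dvd.intro_left _ rfl
    · rw [DirectSum.coe_decompose_mul_of_right_mem_of_not_le (grading k n) hh hle]
      exact dvd_zero h
  -- The radical of a homogeneous ideal is the intersection of the homogeneous primes above it. Such
  -- a prime missing f would be a point of U, and the denominator of s near that point lies in I but
  -- not in the prime.
  have hfI : f ∈ I.radical := by
    rw [hIhom.radical_eq, Submodule.mem_sInf]
    rintro J ⟨hJhom, hIJ, hJ⟩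
    by_contra hfJ
    let x : ProjSpace k n := ⟨⟨J, hJhom⟩, hJ, fun hle =>
      hfJ ((HomogeneousIdeal.irrelevant_le _).mp hle e he hf)⟩
    have hxU : x ∈ U := (hU x).mpr hfJ
    obtain ⟨W', hW', hxW', i', j', g', h', hg', hh', hij', hfr'⟩ := hs ⟨x, hxU⟩
    obtain ⟨hx', e'⟩ := hfr' ⟨x, hxW'⟩
    change s ⟨x, hxU⟩ = _ at e'
    have h1 : κ * algebraMap _ _ h' = algebraMap _ _ g' := by
      rw [hκ, hs.germToFrac_eq x₀ ⟨x, hxU⟩, e']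
      exact germToFrac_mk _ _ _ _
    have h2 : h' * g = h * g' := by
      apply algebraMap_funField_injective
      rw [map_mul, map_mul, ← hκgh, ← h1]
      ring
    exact hx' (hIJ ((hI h').mpr ⟨g', h2⟩))
  obtain ⟨N₀, hN₀⟩ := hfI
  -- The extra |d| factors of f make the numerator degree N e + d nonnegative.
  obtain ⟨b, hb⟩ := (hI _).mp (Ideal.mul_mem_right (f ^ d.natAbs) I hN₀)
  rw [← pow_add] at hb
  set N := N₀ + d.natAbs
  obtain ⟨D, hD⟩ : ∃ D : ℕ, (D : ℤ) = N * e + d := by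
    have h1 : (1 : ℤ) ≤ e := by exact_mod_cast he
    have h2 : -d ≤ |d| := neg_le_abs d
    refine ⟨((N : ℤ) * e + d).toNat, Int.toNat_of_nonneg ?_⟩
    simp only [N]
    push_cast
    nlinarith [abs_nonneg d, Int.natCast_nonneg N₀]
  have hfN : f ^ N * g ∈ grading k n (D + j) := by
    have h1 := SetLike.mul_mem_graded (A := grading k n) (SetLike.pow_mem_graded N hf) hg
    rw [smul_eq_mul] at h1
    rwa [show N * e + i = D + j by zify; rw [hD, hij]; ring] at h1
  -- The quotient b need not be known to be homogeneous; its component of degree D already satisfies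
  -- the equation.
  refine ⟨N, (DirectSum.decompose (grading k n) b D : CoordRing k n), ?_, ?_⟩
  · rw [← hD, mem_forms_natCast]
    exact SetLike.coe_mem _
  · have h1 : (DirectSum.decompose (grading k n) b D : CoordRing k n) * h = f ^ N * g := by
      rw [← DirectSum.coe_decompose_mul_add_of_right_mem (grading k n) hh, mul_comm b h, ← hb,
        DirectSum.decompose_of_mem_same _ hfN]
    refine mul_right_cancel₀
      ((map_ne_zero_iff _ algebraMap_funField_injective).mpr hh0) ?_
    rw [← map_mul, h1, map_mul, map_pow, ← hκgh]
    ring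

/-- A fraction with denominator `h` is a section of `O(d)` over any open set on which `h` does not
vanish. -/
theorem isTwistSection_mk {i j : ℕ} {g h : CoordRing k n} (hg : g ∈ grading k n i)
    (hh : h ∈ grading k n j) (hij : (i : ℤ) = j + d)
    (hU : ∀ x ∈ U, h ∉ x.asHomogeneousIdeal.toIdeal) :
    IsTwistSection d fun x : U => Localization.mk g ⟨h, hU x.1 x.2⟩ :=
  fun x => ⟨U, le_rfl, x.2, i, j, g, h, hg, hh, hij, fun y => ⟨hU y.1 y.2, rfl⟩⟩

variable {e : ℕ}

theorem Simplex.mem_opens (σ : Simplex n e) (x : ProjSpace k n) :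
    x ∈ σ.opens k ↔ vprod k σ.verts 1 ∉ x.asHomogeneousIdeal.toIdeal := by
  have h1 : x ∈ σ.opens k ↔
      ∀ v, (MvPolynomial.X (σ v) : CoordRing k n) ∉ x.asHomogeneousIdeal.toIdeal := by
    rw [Simplex.opens, ← SetLike.mem_coe, Opens.coe_iInf]
    simp only [Set.mem_iInter]
    exact Iff.rfl
  rw [h1, vprod_eq_pow, pow_one, Ideal.IsPrime.prod_mem_iff (hp := x.isPrime)]
  simp [Simplex.verts]

theorem Simplex.genericPt_mem_opens (σ : Simplex n e) : genericPt k n ∈ σ.opens k :=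
  (σ.mem_opens _).mpr (notMem_genericPt (vprod_ne_zero _ _))

/-- The value at the generic point. -/
def genericValue {σ : Simplex n e} (s : (x : σ.opens k) → LocalRing k n x.1) : FunField k n :=
  germToFrac (genericPt k n) (s ⟨genericPt k n, σ.genericPt_mem_opens⟩)

theorem IsTwistSection.genericValue_mem {σ : Simplex n e}
    {s : (x : σ.opens k) → LocalRing k n x.1} (hs : IsTwistSection d s) :
    genericValue s ∈ twistFractions k σ.verts d := by
  have hf : vprod k σ.verts 1 ∈ grading k n (e + 1) := by
    have := vprod_mem_forms (k := k) σ.verts 1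
    rwa [← Nat.cast_mul, mem_forms_natCast, one_mul, σ.card_verts] at this
  obtain ⟨N, c, hc, h⟩ := hs.exists_denominator (Nat.succ_pos e) hf σ.mem_opens
    ⟨genericPt k n, σ.genericPt_mem_opens⟩
  refine ⟨N, c, ?_, ?_⟩
  · rwa [σ.card_verts]
  · rwa [vprod_eq_pow, ← pow_one (∏ i ∈ σ.verts, _), ← vprod_eq_pow, map_pow]

theorem exists_section_of_mem_twistFractions {σ : Simplex n e} {κ : FunField k n}
    (hκ : κ ∈ twistFractions k σ.verts d) :
    ∃ s : (x : σ.opens k) → LocalRing k n x.1, IsTwistSection d s ∧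
      ∀ x, germToFrac x.1 (s x) = κ := by
  obtain ⟨N, c, hc, h⟩ := hκ
  by_cases hneg : (N * σ.verts.card + d : ℤ) < 0
  · refine ⟨fun _ => 0, IsTwistSection.zero, fun x => ?_⟩
    rw [eq_zero_of_mem_forms_neg hneg hc, map_zero] at h
    rw [map_zero, (mul_eq_zero.mp h).resolve_right (algebraMap_vprod_ne_zero _ _)]
  · push Not at hneg
    obtain ⟨D, hD⟩ := Int.eq_ofNat_of_zero_le hneg
    rw [hD] at hc
    have hv := vprod_mem_forms (k := k) σ.verts N
    rw [← Nat.cast_mul, mem_forms_natCast] at hv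
    have hU : ∀ x ∈ σ.opens k, vprod k σ.verts N ∉ x.asHomogeneousIdeal.toIdeal := by
      intro x hx hmem
      rw [vprod_eq_pow] at hmem
      have := x.isPrime.mem_of_pow_mem _ hmem
      rw [σ.mem_opens, vprod_eq_pow, pow_one] at hx
      exact hx this
    refine ⟨_, isTwistSection_mk (mem_forms_natCast.mp hc) hv (by rw [← hD]; push_cast; ring) hU,
      fun x => ?_⟩
    refine mul_right_cancel₀ (algebraMap_vprod_ne_zero σ.verts N) ?_
    rw [h]
    exact germToFrac_mk _ _ _ _

end Sections

/-! ### The Čech complex of `O(d)` with values in the function field -/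

section FractionComplex

variable {k : Type*} [Field k] {n : ℕ} {d : ℤ}

theorem sum_sum_face_face {R : Type*} [CommRing R] {e : ℕ} (v : Simplex n e → R)
    (ρ : Simplex n (e + 2)) :
    ∑ m : Fin (e + 3), (-1) ^ (m : ℕ) *
      ∑ l : Fin (e + 2), (-1) ^ (l : ℕ) * v ((ρ.face m).face l) = 0 := by
  have hsum : ∑ m : Fin (e + 3), (-1) ^ (m : ℕ) *
      ∑ l : Fin (e + 2), (-1) ^ (l : ℕ) * v ((ρ.face m).face l) =
      ∑ ml : Fin (e + 3) × Fin (e + 2),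
        (-1) ^ ((ml.1 : ℕ) + (ml.2 : ℕ)) * v ((ρ.face ml.1).face ml.2) := by
    simp only [Fintype.sum_prod_type, Finset.mul_sum, pow_add, mul_assoc]
  rw [hsum]
  refine Finset.sum_involution
    (fun ml _ => (ml.1.succAbove ml.2, ml.2.predAbove ml.1)) ?_ ?_ ?_ ?_
  · rintro ⟨j, i⟩ -
    simp only [Simplex.face_face, Fin.neg_one_pow_succAbove_add_predAbove]
    ring
  · rintro ⟨j, i⟩ - - h
    exact Fin.succAbove_ne j i (congrArg Prod.fst h)
  · simp
  · rintro ⟨j, i⟩ -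
    simp [Fin.succAbove_succAbove_predAbove, Fin.predAbove_predAbove_succAbove]

/-- The simplex with the single vertex `i`. -/
def Simplex.vertex (i : Fin (n + 1)) : Simplex n 0 :=
  OrderEmbedding.ofStrictMono (fun _ => i) fun v v' h => absurd h (by omega)

theorem Simplex.fin_eq_zero (v : Fin (0 + 1)) : v = 0 := Fin.fin_one_eq_zero v

theorem Simplex.eq_of_zero_eq {τ τ' : Simplex n 0} (h : τ 0 = τ' 0) : τ = τ' :=
  RelEmbedding.ext fun v => by rw [Simplex.fin_eq_zero v, h]

theorem eq_of_cocycle_zero {R : Type*} [CommRing R] {y : Simplex n 0 → R}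
    (hy : ∀ ρ : Simplex n 1, ∑ m : Fin 2, (-1) ^ (m : ℕ) * y (ρ.face m) = 0)
    (τ τ' : Simplex n 0) : y τ = y τ' := by
  have hface : ∀ ρ : Simplex n 1, ∀ l l', y (ρ.face l) = y (ρ.face l') := by
    intro ρ
    have h := hy ρ
    simp only [Fin.sum_univ_two, Fin.val_zero, pow_zero, one_mul, Fin.val_one, pow_one,
      neg_one_mul, add_neg_eq_zero] at h
    intro l l'
    fin_cases l <;> fin_cases l' <;> simp [h]
  by_cases hmem : τ' 0 ∈ Set.range τ
  · obtain ⟨v, hv⟩ := hmem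
    rw [Simplex.fin_eq_zero v] at hv
    rw [Simplex.eq_of_zero_eq hv]
  · obtain ⟨ρ, l, hl, rfl⟩ := τ.exists_insert hmem
    obtain ⟨l', hl'⟩ := exists_ne l
    obtain ⟨v, hv⟩ := Fin.exists_succAbove_eq hl'.symm
    rw [Simplex.fin_eq_zero v] at hv
    have : ρ.face l' = τ' := Simplex.eq_of_zero_eq (by rw [Simplex.face_apply, hv, hl])
    rw [hface ρ l l', this]

/-- Degree `0` cocycles of the Čech complex of `O(d)` are forms. -/
theorem exists_form_of_cocycle_zero (hn : 1 ≤ n) {y : Simplex n 0 → FunField k n}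
    (hy : ∀ τ, y τ ∈ twistFractions k τ.verts d)
    (hcoc : ∀ ρ : Simplex n 1, ∑ m : Fin 2, (-1) ^ (m : ℕ) * y (ρ.face m) = 0) :
    ∃ g ∈ forms k n d, ∀ τ, y τ = algebraMap _ _ g := by
  let τ₀ : Simplex n 0 := Simplex.vertex 0
  let τ₁ : Simplex n 0 := Simplex.vertex (Fin.last n)
  have hdisj : Disjoint τ₀.verts τ₁.verts := by
    rw [← Finset.disjoint_coe, Simplex.coe_verts, Simplex.coe_verts, Set.disjoint_left]
    rintro _ ⟨v, rfl⟩ ⟨v', hv'⟩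
    have h : Fin.last n = 0 := hv'
    have := congrArg Fin.val h
    simp at this
    omega
  have h₁ := hy τ₁
  rw [eq_of_cocycle_zero hcoc τ₁ τ₀] at h₁
  obtain ⟨g, hg, h⟩ := exists_form_of_mem_twistFractions hdisj (hy τ₀) h₁
  exact ⟨g, hg, fun τ => by rw [eq_of_cocycle_zero hcoc τ τ₀, h]⟩

end FractionComplex

/-! ### Sections of the kernel -/

section Kernel

variable {k : Type*} [Field k] {n p q : ℕ} {A : LinearMatrix k n p q} {a : ℤ}

/-- The matrix of linear forms acting on tuples of fractions. -/
def LinearMatrix.applyFrac (A : LinearMatrix k n p q) :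
    (Fin p → FunField k n) →ₗ[FunField k n] (Fin q → FunField k n) :=
  Matrix.mulVecLin (Matrix.of fun i j => algebraMap _ _ (A.entry i j))

theorem LinearMatrix.applyFrac_apply (A : LinearMatrix k n p q) (v : Fin p → FunField k n)
    (i : Fin q) : A.applyFrac v i = ∑ j, algebraMap _ _ (A.entry i j) * v j := rfl

theorem LinearMatrix.entry_mem_forms (A : LinearMatrix k n p q) (i : Fin q) (j : Fin p) :
    A.entry i j ∈ forms k n 1 := by
  have h : A.entry i j ∈ grading k n 1 := Submodule.sum_mem _ fun l _ =>
    Submodule.smul_mem _ _ (MvPolynomial.isHomogeneous_X k l)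
  simpa using mem_forms_natCast.mpr h

theorem germToFrac_apply (A : LinearMatrix k n p q) {x : ProjSpace k n}
    (v : Fin p → LocalRing k n x) (i : Fin q) :
    germToFrac x (A.apply v i) = A.applyFrac (fun j => germToFrac x (v j)) i := by
  simp only [LinearMatrix.apply, LinearMatrix.applyFrac_apply, map_sum, map_mul,
    germToFrac_algebraMap]

theorem LinearMatrix.applyFrac_mem (A : LinearMatrix k n p q) {T : Finset (Fin (n + 1))}
    {v : Fin p → FunField k n} (hv : ∀ j, v j ∈ twistFractions k T a) (i : Fin q) :
    A.applyFrac v i ∈ twistFractions k T (a + 1) := by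
  rw [LinearMatrix.applyFrac_apply]
  exact sum_mem fun j _ => algebraMap_mul_mem_twistFractions (A.entry_mem_forms i j) (hv j)

theorem LinearMatrix.applyFrac_sum (A : LinearMatrix k n p q) {ι : Type*} [Fintype ι]
    (ε : ι → FunField k n) (v : ι → Fin p → FunField k n) :
    A.applyFrac (fun j => ∑ m, ε m * v m j) = fun i => ∑ m, ε m * A.applyFrac (v m) i := by
  have h : (fun j => ∑ m, ε m * v m j) = ∑ m, ε m • v m := by
    funext j
    simp
  rw [h, map_sum]
  funext i
  simp

theorem LinearMatrix.applyFrac_algebraMap (A : LinearMatrix k n p q) (v : Fin p → CoordRing k n)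
    (i : Fin q) : A.applyFrac (fun j => algebraMap _ _ (v j)) i =
      algebraMap _ _ (∑ j, A.entry i j * v j) := by
  simp only [LinearMatrix.applyFrac_apply, map_sum, map_mul]

variable {e : ℕ}

/-- The value of a section of `V(a)` at the generic point. -/
def kernelValue {σ : Simplex n e} (s : kernelSections A a (σ.opens k)) (j : Fin p) :
    FunField k n :=
  genericValue fun x => s.1 x j

theorem kernelValue_mem {σ : Simplex n e} (s : kernelSections A a (σ.opens k)) (j : Fin p) :
    kernelValue s j ∈ twistFractions k σ.verts a :=
  (s.2.1 j).genericValue_mem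

theorem applyFrac_kernelValue {σ : Simplex n e} (s : kernelSections A a (σ.opens k)) :
    A.applyFrac (kernelValue s) = 0 := by
  funext i
  have h := congrArg (germToFrac (genericPt k n))
    (congrFun (s.2.2 ⟨genericPt k n, σ.genericPt_mem_opens⟩) i)
  rw [germToFrac_apply, Pi.zero_apply, map_zero] at h
  exact h

theorem kernelValue_injective {σ : Simplex n e} {s s' : kernelSections A a (σ.opens k)}
    (h : kernelValue s = kernelValue s') : s = s' := by
  refine Subtype.ext (funext fun x => funext fun j => germToFrac_injective x.1 ?_)
  have h1 := (s.2.1 j).germToFrac_eq x ⟨genericPt k n, σ.genericPt_mem_opens⟩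
  have h2 := (s'.2.1 j).germToFrac_eq x ⟨genericPt k n, σ.genericPt_mem_opens⟩
  exact h1.trans ((congrFun h j).trans h2.symm)

/-- With injectivity of `kernelValue`, this identifies sections of V(a) over U_σ with tuples of
fractions killed by A, so cohomology can be computed in the function field. -/
theorem exists_kernelValue_eq {σ : Simplex n e} {v : Fin p → FunField k n}
    (hv : ∀ j, v j ∈ twistFractions k σ.verts a) (hA : A.applyFrac v = 0) :
    ∃ s : kernelSections A a (σ.opens k), kernelValue s = v := by
  choose s hs hsv using fun j => exists_section_of_mem_twistFractions (hv j)
  have hmem : (fun (x : σ.opens k) j => s j x) ∈ kernelSections A a (σ.opens k) := by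
    refine ⟨hs, fun x => funext fun i => germToFrac_injective x.1 ?_⟩
    rw [germToFrac_apply, Pi.zero_apply, map_zero]
    simp only [hsv]
    exact congrFun hA i
  exact ⟨⟨_, hmem⟩, funext fun j => hsv j ⟨genericPt k n, σ.genericPt_mem_opens⟩⟩

theorem kernelValue_cechD (s : Cochain A a e) (σ : Simplex n (e + 1)) (j : Fin p) :
    kernelValue (cechD A a e s σ) j =
      ∑ m : Fin (e + 2), (-1) ^ (m : ℕ) * kernelValue (s (σ.face m)) j := by
  have h := congrFun (cechD_apply A a e s σ ⟨genericPt k n, σ.genericPt_mem_opens⟩) j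
  refine (congrArg (germToFrac (genericPt k n)) (h.trans (Finset.sum_apply j _ _))).trans ?_
  rw [map_sum]
  exact Finset.sum_congr rfl fun m _ => germToFrac_smul _ _ _

theorem sum_kernelValue_of_cocycle {z : Cochain A a e} (hz : cechD A a e z = 0)
    (ρ : Simplex n (e + 1)) (j : Fin p) :
    ∑ m : Fin (e + 2), (-1) ^ (m : ℕ) * kernelValue (z (ρ.face m)) j = 0 := by
  rw [← kernelValue_cechD, hz]
  exact map_zero (germToFrac (genericPt k n))

/-- Cochains with prescribed values at the generic point. -/
theorem mem_range_cechD {z : Cochain A a (e + 1)} (y : Fin p → Simplex n e → FunField k n)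
    (hy : ∀ j τ, y j τ ∈ twistFractions k τ.verts a)
    (hA : ∀ τ, A.applyFrac (fun j => y j τ) = 0)
    (hyz : ∀ j σ, ∑ m : Fin (e + 2), (-1) ^ (m : ℕ) * y j (σ.face m) = kernelValue (z σ) j) :
    z ∈ coboundaries A a (e + 1) := by
  choose s hs using fun τ => exists_kernelValue_eq (fun j => hy j τ) (hA τ)
  refine ⟨s, funext fun σ => kernelValue_injective (funext fun j => ?_)⟩
  refine (kernelValue_cechD (A := A) (a := a) s σ j).trans ?_
  rw [← hyz]
  exact Finset.sum_congr rfl fun m _ => congrArg _ (congrFun (hs (σ.face m)) j)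

/-! ### Vanishing of cohomology -/

theorem not_nontrivial_cohomology (h : ∀ z, cechD A a e z = 0 → z ∈ coboundaries A a e) :
    ¬ Nontrivial (Cohomology A a e) := by
  rw [not_nontrivial_iff_subsingleton, Submodule.Quotient.subsingleton_iff, eq_top_iff]
  exact fun z _ => h z.1 (LinearMap.mem_ker.mp z.2)

theorem not_nontrivial_cohomology_of_lt (he : n < e) : ¬ Nontrivial (Cohomology A a e) := by
  refine not_nontrivial_cohomology fun z _ => ?_
  have : IsEmpty (Simplex n e) := ⟨fun σ => by
    have := Fintype.card_le_of_injective σ σ.injective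
    simp at this
    omega⟩
  have hz : z = 0 := funext fun σ => isEmptyElim σ
  rw [hz]
  exact zero_mem _

/-- A 0-cocycle is a tuple of global forms of degree a killed by A. -/
theorem not_nontrivial_cohomology_zero (hn : 1 ≤ n)
    (hinj : ∀ v : Fin p → CoordRing k n, (∀ j, v j ∈ forms k n a) →
      (∀ i, ∑ j, A.entry i j * v j = 0) → v = 0) : ¬ Nontrivial (Cohomology A a 0) := by
  refine not_nontrivial_cohomology fun z hz => ?_
  choose g hg hzg using fun j => exists_form_of_cocycle_zero hn
    (y := fun τ => kernelValue (z τ) j) (fun τ => kernelValue_mem (z τ) j)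
    fun ρ => sum_kernelValue_of_cocycle hz ρ j
  have hg0 : g = 0 := by
    refine hinj g hg fun i => algebraMap_funField_injective ?_
    rw [← LinearMatrix.applyFrac_algebraMap, map_zero]
    have h := congrFun (applyFrac_kernelValue (z (Simplex.vertex 0))) i
    rwa [show kernelValue (z (Simplex.vertex 0)) = fun j => algebraMap _ _ (g j) from
      funext fun j => hzg j _] at h
  have hz0 : z = 0 := funext fun τ => kernelValue_injective (funext fun j => by
    rw [hzg j τ, hg0]
    exact (map_zero (algebraMap (CoordRing k n) _)).trans
      (map_zero (germToFrac (genericPt k n))).symm)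
  rw [hz0]
  exact zero_mem _

/-- The connecting map made explicit: write z = dy in O(a)^p. Then Ay is a 0-cocycle, hence a tuple
of forms; lifting it to forms v, the cochain y - v lies in V(a) and has the same differential as y.
-/
theorem not_nontrivial_cohomology_one (hn : 1 ≤ n) (ha : 1 < n ∨ -(n : ℤ) ≤ a)
    (hsurj : ∀ w : Fin q → CoordRing k n, (∀ i, w i ∈ forms k n (a + 1)) →
      ∃ v : Fin p → CoordRing k n, (∀ j, v j ∈ forms k n a) ∧ ∀ i, ∑ j, A.entry i j * v j = w i) :
    ¬ Nontrivial (Cohomology A a 1) := by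
  refine not_nontrivial_cohomology fun z hz => ?_
  choose y hy hyz using fun j => exists_cech_primitive_fractions (e := 0) ha
    (fun σ => kernelValue (z σ) j) (fun σ => kernelValue_mem (z σ) j)
    fun ρ => sum_kernelValue_of_cocycle hz ρ j
  choose w hw hyw using fun i => exists_form_of_cocycle_zero hn
    (y := fun τ => A.applyFrac (fun j => y j τ) i)
    (fun τ => A.applyFrac_mem (fun j => hy j τ) i) fun ρ => by
      have h := congrFun (A.applyFrac_sum (fun m : Fin 2 => (-1) ^ (m : ℕ))
        fun m j => y j (ρ.face m)) i
      rw [← h]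
      simp only [hyz]
      exact congrFun (applyFrac_kernelValue (z ρ)) i
  obtain ⟨v, hv, hvw⟩ := hsurj w hw
  refine mem_range_cechD (fun j τ => y j τ - algebraMap _ _ (v j)) (fun j τ => ?_)
    (fun τ => ?_) fun j σ => ?_
  · exact sub_mem (hy j τ) ⟨0, v j, by simpa using hv j, by simp [vprod_eq_pow]⟩
  · have h : (fun j => y j τ - algebraMap _ _ (v j)) =
        (fun j => y j τ) - fun j => algebraMap _ _ (v j) := rfl
    funext i
    rw [h, map_sub, Pi.sub_apply, hyw, LinearMatrix.applyFrac_algebraMap, hvw, sub_self,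
      Pi.zero_apply]
  · rw [← hyz]
    simp [Fin.sum_univ_two, ← sub_eq_add_neg]

/-- `O(a)^p → O(a+1)^q` is surjective on sections over the open sets `∏_{i ∈ T} x_i ≠ 0`. -/
theorem LinearMatrix.SurjectiveInDegree.exists_lift {b : ℕ} (hb : A.SurjectiveInDegree b)
    {T : Finset (Fin (n + 1))} (hT : T.Nonempty) {w : Fin q → FunField k n}
    (hw : ∀ i, w i ∈ twistFractions k T (a + 1)) :
    ∃ v : Fin p → FunField k n, (∀ j, v j ∈ twistFractions k T a) ∧ A.applyFrac v = w := by
  -- With N ≥ |a| + b and T nonempty, the lifted numerators have degree N·|T| + a ≥ b, where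
  -- surjectivity is available.
  obtain ⟨N, hN, hwN⟩ := exists_common_denominator hw (a.natAbs + b)
  choose c hc hwc using hwN
  obtain ⟨D, hD⟩ : ∃ D : ℕ, (D : ℤ) = N * T.card + a := by
    have h1 : (1 : ℤ) ≤ T.card := by exact_mod_cast hT.card_pos
    have h2 : -a ≤ |a| := neg_le_abs a
    have h3 : |a| + b ≤ N := by
      rw [Int.abs_eq_natAbs]
      exact_mod_cast hN
    refine ⟨((N : ℤ) * T.card + a).toNat, Int.toNat_of_nonneg ?_⟩
    nlinarith [Int.natCast_nonneg N, Int.natCast_nonneg b]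
  have hbD : b ≤ D := by
    have h1 : (1 : ℤ) ≤ T.card := by exact_mod_cast hT.card_pos
    have h2 : -a ≤ |a| := neg_le_abs a
    have h3 : |a| + b ≤ N := by
      rw [Int.abs_eq_natAbs]
      exact_mod_cast hN
    have : (b : ℤ) ≤ D := by
      rw [hD]
      nlinarith [Int.natCast_nonneg N]
    exact_mod_cast this
  have hc' : ∀ i, c i ∈ grading k n (D + 1) := fun i => by
    rw [← mem_forms_natCast, Nat.cast_add, hD, Nat.cast_one, add_assoc]
    exact hc i
  obtain ⟨v, hv, hvc⟩ := hb.of_le hbD c hc'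
  have hP := algebraMap_vprod_ne_zero (k := k) T N
  set P := algebraMap (CoordRing k n) (FunField k n) (vprod k T N)
  refine ⟨P⁻¹ • fun j => algebraMap _ _ (v j), fun j => ⟨N, v j, ?_, ?_⟩, ?_⟩
  · rw [← hD, mem_forms_natCast]
    exact hv j
  · rw [Pi.smul_apply, smul_eq_mul, mul_comm, mul_inv_cancel_left₀ hP]
  · funext i
    rw [map_smul, Pi.smul_apply, LinearMatrix.applyFrac_algebraMap, hvc, ← hwc, smul_eq_mul,
      mul_comm, mul_assoc, mul_inv_cancel₀ hP, mul_one]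

/-- The diagram chase one step further: z = dy in O(a)^p, Ay = dw in O(a+1)^q, and w lifts over each
affine piece to some v with Av = w. Then y - dv lies in V(a) and has differential z. -/
theorem not_nontrivial_cohomology_add_two {b : ℕ} (hb : A.SurjectiveInDegree b)
    (ha : e + 2 < n ∨ -(n : ℤ) ≤ a) : ¬ Nontrivial (Cohomology A a (e + 2)) := by
  refine not_nontrivial_cohomology fun z hz => ?_
  choose y hy hyz using fun j => exists_cech_primitive_fractions (e := e + 1) ha
    (fun σ => kernelValue (z σ) j) (fun σ => kernelValue_mem (z σ) j)
    fun ρ => sum_kernelValue_of_cocycle hz ρ j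
  choose w hw hwy using fun i => exists_cech_primitive_fractions (e := e) (d := a + 1)
    (ha.imp (fun h => by omega) fun h => by omega)
    (fun τ => A.applyFrac (fun j => y j τ) i)
    (fun τ => A.applyFrac_mem (fun j => hy j τ) i) fun ρ => by
      have h := congrFun (A.applyFrac_sum (fun m : Fin (e + 3) => (-1) ^ (m : ℕ))
        fun m j => y j (ρ.face m)) i
      rw [← h]
      simp only [hyz]
      exact congrFun (applyFrac_kernelValue (z ρ)) i
  choose v hv hvw using fun τ : Simplex n e =>
    hb.exists_lift (T := τ.verts) ⟨τ 0, by simp [Simplex.verts]⟩ fun i => hw i τ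
  refine mem_range_cechD
    (fun j τ => y j τ - ∑ m : Fin (e + 2), (-1) ^ (m : ℕ) * v (τ.face m) j) (fun j τ => ?_)
    (fun τ => ?_) fun j σ => ?_
  · exact sub_mem (hy j τ) (sum_mem fun m _ => neg_one_pow_mul_mem
      (twistFractions_mono (τ.verts_face_subset m) a (hv _ j)) m)
  · have h : (fun j => y j τ - ∑ m : Fin (e + 2), (-1) ^ (m : ℕ) * v (τ.face m) j) =
        (fun j => y j τ) - fun j => ∑ m : Fin (e + 2), (-1) ^ (m : ℕ) * v (τ.face m) j := rfl
    funext i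
    rw [h, map_sub, Pi.sub_apply, A.applyFrac_sum, Pi.zero_apply, sub_eq_zero, ← hwy]
    simp only [hvw]
  · simp only [mul_sub, Finset.sum_sub_distrib]
    rw [hyz, sum_sum_face_face (fun τ => v τ j) σ, sub_zero]

/-- The map of sheaves is surjective if it is so on forms of some degree. -/
theorem LinearMatrix.SurjectiveInDegree.isSurjective {b : ℕ} (hb : A.SurjectiveInDegree b) :
    A.IsSurjective := by
  intro U w hw x
  choose W hW hxW i j g h hg hh hij hfr using fun r => hw r x
  obtain ⟨l, hl⟩ := exists_X_notMem x.1
  let W₀ : Opens (ProjSpace k n) :=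
    (U ⊓ ⨅ r, W r) ⊓ ProjectiveSpectrum.basicOpen (grading k n) (MvPolynomial.X l)
  have hW₀ : ∀ y ∈ W₀, ∀ r, y ∈ W r := fun y hy r => (iInf_le W r) hy.1.2
  have hxW₀ : x.1 ∈ W₀ := by
    refine ⟨⟨x.2, ?_⟩, hl⟩
    rw [Opens.coe_iInf]
    exact Set.mem_iInter.mpr hxW
  -- The factor x_l^b, invertible on `W₀`, raises the numerators into degrees where the map on forms
  -- is surjective.
  let H : CoordRing k n := (∏ r, h r) * MvPolynomial.X l ^ b
  have hXb : (MvPolynomial.X l : CoordRing k n) ^ b ∈ grading k n b :=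
    MvPolynomial.isHomogeneous_X_pow l b
  have hH : H ∈ grading k n (∑ r, j r + b) :=
    SetLike.mul_mem_graded (MvPolynomial.IsHomogeneous.prod _ _ _ fun r _ => hh r) hXb
  have hHW : ∀ y ∈ W₀, H ∉ y.asHomogeneousIdeal.toIdeal := by
    intro y hy hmem
    rcases y.isPrime.mem_or_mem hmem with h1 | h1
    · obtain ⟨r, -, hr⟩ := (Ideal.IsPrime.prod_mem_iff (hp := y.isPrime)).mp h1
      exact (hfr r ⟨y, hW₀ y hy r⟩).1 hr
    · exact hy.2 (y.isPrime.mem_of_pow_mem _ h1)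
  let G : Fin q → CoordRing k n := fun r =>
    g r * (∏ r' ∈ Finset.univ.erase r, h r') * MvPolynomial.X l ^ b
  have hG : ∀ r, G r ∈ grading k n (∑ r, j r + b + 1) := fun r => by
    have h1 := SetLike.mul_mem_graded (A := grading k n) (SetLike.mul_mem_graded
      (A := grading k n) (hg r) (MvPolynomial.IsHomogeneous.prod (Finset.univ.erase r) _ _
        fun r _ => hh r)) hXb
    have h2 : ∑ r, j r = j r + ∑ r' ∈ Finset.univ.erase r, j r' :=
      (Finset.add_sum_erase _ _ (Finset.mem_univ r)).symm
    have h3 := hij r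
    rwa [show i r + ∑ r' ∈ Finset.univ.erase r, j r' + b = ∑ r, j r + b + 1 by omega] at h1
  obtain ⟨v, hv, hvG⟩ := hb.of_le (Nat.le_add_left b (∑ r, j r)) G hG
  refine ⟨W₀, inf_le_left.trans inf_le_left,
    fun y c => Localization.mk (v c) ⟨H, hHW y.1 y.2⟩, hxW₀, fun c => ?_, fun y => ?_⟩
  · exact isTwistSection_mk (hv c) hH (by simp) hHW
  · funext r
    apply germToFrac_injective y.1
    have hH0 : algebraMap (CoordRing k n) (FunField k n) H ≠ 0 :=
      (map_ne_zero_iff _ algebraMap_funField_injective).mpr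
        fun h0 => hHW y.1 y.2 (h0 ▸ zero_mem _)
    refine mul_right_cancel₀ hH0 ?_
    rw [germToFrac_apply, LinearMatrix.applyFrac_apply, Finset.sum_mul]
    simp only [mul_assoc, germToFrac_mk]
    obtain ⟨hy, e₁⟩ := hfr r ⟨y.1, hW₀ y.1 y.2 r⟩
    have h1 := germToFrac_mk y.1 (g r) (h r) hy
    rw [← e₁] at h1
    have h2 : H = h r * ((∏ r' ∈ Finset.univ.erase r, h r') * MvPolynomial.X l ^ b) := by
      rw [← mul_assoc, Finset.mul_prod_erase _ _ (Finset.mem_univ r)]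
    rw [h2, map_mul, ← mul_assoc, h1, ← map_mul, ← mul_assoc]
    simp only [← map_mul, ← map_sum]
    rw [hvG]

end Kernel

/-! ### Natural cohomology of general kernels -/

theorem HoldsForGeneral.of_ne_zero {k ι : Type*} [Field k] [Infinite k] {P : (ι → k) → Prop}
    {f : MvPolynomial ι k} (hf : f ≠ 0) (h : ∀ A, MvPolynomial.eval A f ≠ 0 → P A) :
    HoldsForGeneral P := by
  refine ⟨f, ?_, h⟩
  by_contra! hcon
  exact hf (MvPolynomial.funext fun A => by rw [hcon A, map_zero])

variable {k : Type*} [Field k] {n p q : ℕ} {A : LinearMatrix k n p q}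

/-- `V` has natural cohomology if in each degree the map on forms is injective or surjective. -/
theorem hasNaturalCohomology_of_injective_or_surjective (hn : 1 ≤ n) {b : ℕ}
    (hb : A.SurjectiveInDegree b)
    (h : ∀ a : ℕ, A.InjectiveInDegree a ∨ A.SurjectiveInDegree a) : HasNaturalCohomology A := by
  intro a
  suffices hex : ∃ e₀, ∀ e, e ≠ e₀ → ¬ Nontrivial (Cohomology A a e) by
    obtain ⟨e₀, he₀⟩ := hex
    intro e e' he he'
    rw [not_imp_not.mp (he₀ e) he, not_imp_not.mp (he₀ e') he']
  have hH0 : a < 0 → ¬ Nontrivial (Cohomology A a 0) := fun ha =>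
    not_nontrivial_cohomology_zero hn fun v hv _ =>
      funext fun j => eq_zero_of_mem_forms_neg ha (hv j)
  -- The degree that may survive is n for a < -n, 1 for -n ≤ a < 0, and for a ≥ 0 it is 1 or 0
  -- according to injectivity or surjectivity on forms.
  rcases lt_or_ge a (-(n : ℤ)) with ha | ha
  · refine ⟨n, fun e he => ?_⟩
    rcases lt_or_gt_of_ne he with hlt | hgt
    · match e, hlt with
      | 0, _ => exact hH0 (by omega)
      | 1, hlt =>
        refine not_nontrivial_cohomology_one hn (Or.inl hlt) fun w hw => ⟨0, fun _ => zero_mem _,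
          fun i => ?_⟩
        rw [eq_zero_of_mem_forms_neg (by omega) (hw i)]
        simp
      | e + 2, hlt => exact not_nontrivial_cohomology_add_two hb (Or.inl hlt)
    · exact not_nontrivial_cohomology_of_lt hgt
  · have hge2 : ∀ e, ¬ Nontrivial (Cohomology A a (e + 2)) := fun e =>
      not_nontrivial_cohomology_add_two hb (Or.inr ha)
    rcases lt_or_ge a 0 with ha0 | ha0
    · refine ⟨1, fun e he => ?_⟩
      match e, he with
      | 0, _ => exact hH0 ha0
      | e + 2, _ => exact hge2 e
    · lift a to ℕ using ha0
      rcases h a with hinj | hsurj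
      · refine ⟨1, fun e he => ?_⟩
        match e, he with
        | 0, _ =>
          exact not_nontrivial_cohomology_zero hn fun v hv =>
            hinj v fun j => mem_forms_natCast.mp (hv j)
        | e + 2, _ => exact hge2 e
      · refine ⟨0, fun e he => ?_⟩
        match e, he with
        | 1, _ =>
          refine not_nontrivial_cohomology_one hn (Or.inr ha) fun w hw => ?_
          obtain ⟨v, hv, hvw⟩ := hsurj w fun i => mem_forms_natCast.mp (by exact_mod_cast hw i)
          exact ⟨v, fun j => mem_forms_natCast.mpr (hv j), hvw⟩
        | e + 2, _ => exact hge2 e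

/-! ### Comparison of the dimensions of source and target in degree a -/

theorem mul_card_le_of_le {n a t r m : ℕ} (h : r * (a + 1) ≤ t * n) :
    m * (t + r) * Fintype.card (Mon n a) ≤ m * t * Fintype.card (Mon n (a + 1)) := by
  have hc := Mon.card_succ n a
  set N := Fintype.card (Mon n a)
  set N' := Fintype.card (Mon n (a + 1))
  refine le_of_mul_le_mul_right (a := a + 1) ?_ (Nat.succ_pos a)
  calc m * (t + r) * N * (a + 1) = m * N * (t * (a + 1) + r * (a + 1)) := by ring
    _ ≤ m * N * (t * (a + 1) + t * n) := by gcongr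
    _ = m * t * (N * (a + n + 1)) := by ring
    _ = m * t * N' * (a + 1) := by rw [← hc]; ring

theorem mul_card_le_of_ge {n a t r m : ℕ} (h : t * n ≤ r * (a + 1)) :
    m * t * Fintype.card (Mon n (a + 1)) ≤ m * (t + r) * Fintype.card (Mon n a) := by
  have hc := Mon.card_succ n a
  set N := Fintype.card (Mon n a)
  set N' := Fintype.card (Mon n (a + 1))
  refine le_of_mul_le_mul_right (a := a + 1) ?_ (Nat.succ_pos a)
  calc m * t * N' * (a + 1) = m * t * (N * (a + n + 1)) := by rw [← hc]; ring
    _ = m * N * (t * (a + 1) + t * n) := by ring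
    _ ≤ m * N * (t * (a + 1) + r * (a + 1)) := by gcongr
    _ = m * (t + r) * N * (a + 1) := by ring

end SteinerBundle

end

/-! ### The two critical degrees and the theorem -/

open SteinerBundle in
theorem theorem2p10 {k : Type*} [Field k] [IsAlgClosed k] (n t r m α β : ℕ)
    (hn : 1 ≤ n) (ht : 1 ≤ t) (hr : 1 ≤ r)
    (hα : α = ⌈((t * n : ℕ) : ℚ) / (r : ℚ)⌉₊) (hβ : β = ⌊((t * n : ℕ) : ℚ) / (r : ℚ)⌋₊)
    (hm : max
        (1 / (4 * ((t : ℚ) + r)) * ((α + n - 1).choose n : ℚ) ^ 2 * ((α + n).choose n : ℚ))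
        (1 / (4 * (t : ℚ)) * ((β + n - 1).choose n : ℚ) ^ 3) ≤ (m : ℚ)) :
    SteinerBundle.HoldsForGeneral
      (fun A : SteinerBundle.LinearMatrix k n (m * (t + r)) (m * t) =>
        A.IsSurjective ∧ SteinerBundle.HasNaturalCohomology A) := by
  have hr0 : (0 : ℚ) < r := by exact_mod_cast hr
  have ht0 : (0 : ℚ) < t := by exact_mod_cast ht
  have hx0 : (0 : ℚ) < ((t * n : ℕ) : ℚ) / (r : ℚ) :=
    div_pos (by exact_mod_cast Nat.mul_pos ht hn) hr0
  have hα1 : 1 ≤ α := hα ▸ Nat.ceil_pos.mpr hx0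
  have hαβ : α ≤ β + 1 := by
    rw [hα, hβ]
    exact Nat.ceil_le_floor_add_one _
  have hαr : t * n ≤ r * α := by
    have := Nat.le_ceil (((t * n : ℕ) : ℚ) / (r : ℚ))
    rw [← hα, div_le_iff₀ hr0] at this
    rw [mul_comm r]
    exact_mod_cast this
  have hβr : r * β ≤ t * n := by
    have := Nat.floor_le hx0.le
    rw [← hβ, le_div_iff₀ hr0] at this
    rw [mul_comm r]
    exact_mod_cast this
  obtain ⟨hm₁, hm₂⟩ := max_le_iff.mp hm
  -- Degree α - 1 is the first in which r(a+1) ≥ tn, the numerical condition for surjectivity.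
  obtain ⟨a, rfl⟩ : ∃ a, α = a + 1 := ⟨α - 1, by omega⟩
  have hp : Fintype.card (Mon n a) ^ 2 * Fintype.card (Mon n (a + 1)) ≤ 4 * (m * (t + r)) := by
    rw [mul_assoc, one_div, inv_mul_le_iff₀ (by positivity),
      show a + 1 + n - 1 = a + n by omega] at hm₁
    rw [Mon.card, Mon.card]
    have : ((((a + n).choose n) ^ 2 * (a + 1 + n).choose n : ℕ) : ℚ) ≤
        ((4 * (m * (t + r)) : ℕ) : ℚ) := by
      push_cast
      refine hm₁.trans (le_of_eq (by ring))
    exact_mod_cast this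
  have hq : ∀ b, β = b + 1 → Fintype.card (Mon n b) ^ 3 ≤ 4 * (m * t) := by
    rintro b rfl
    rw [one_div, inv_mul_le_iff₀ (by positivity), show b + 1 + n - 1 = b + n by omega] at hm₂
    rw [Mon.card]
    have : ((((b + n).choose n) ^ 3 : ℕ) : ℚ) ≤ ((4 * (m * t) : ℕ) : ℚ) := by
      push_cast
      refine hm₂.trans (le_of_eq (by ring))
    exact_mod_cast this
  obtain ⟨f, hf, hfA⟩ := exists_open_surjective k (mul_card_le_of_ge hαr) hp
  obtain ⟨g, hg, hgA⟩ : ∃ g : MvPolynomial (Fin (m * t) × Fin (m * (t + r)) × Fin (n + 1)) k,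
      g ≠ 0 ∧ ∀ A : LinearMatrix k n (m * (t + r)) (m * t), MvPolynomial.eval A g ≠ 0 →
        ∀ b, b + 1 ≤ β → A.InjectiveInDegree b := by
    -- For β = 0 no degree requires injectivity, and the constant polynomial 1 imposes no condition.
    rcases Nat.eq_zero_or_pos β with hβ0 | hβ0
    · exact ⟨1, one_ne_zero, fun A _ b hb => by omega⟩
    · obtain ⟨c, hc⟩ : ∃ c, β = c + 1 := ⟨β - 1, by omega⟩
      obtain ⟨g, hg, hgA⟩ := exists_open_injective k (mul_card_le_of_le (hc ▸ hβr)) (hq c hc)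
      exact ⟨g, hg, fun A hA b hb =>
        (LinearMatrix.injectiveInDegree_of_coeffMatrix (hgA A hA)).of_le (by omega)⟩
  refine HoldsForGeneral.of_ne_zero (mul_ne_zero hf hg) fun A hA => ?_
  rw [map_mul] at hA
  have hsurj := LinearMatrix.surjectiveInDegree_of_coeffMatrix (hfA A (left_ne_zero_of_mul hA))
  refine ⟨hsurj.isSurjective,
    hasNaturalCohomology_of_injective_or_surjective hn hsurj fun b => ?_⟩
  -- Because α ≤ β + 1, a degree b ≥ β is at least α - 1, so no degree is left uncovered.
  by_cases hb : b + 1 ≤ β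
  · exact Or.inl (hgA A (right_ne_zero_of_mul hA) b hb)
  · exact Or.inr (hsurj.of_le (by omega))
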